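/- \textbf{Setting.} Let $T>0$, let $X$ be a complex Banach space, and let $A:\mathcal D(A)\subset X\to X$, $B:\mathcal D(B)\subset X\to X$ be linear operators such that $A$, $B$ and $A+B$ (with $\mathcal D(A+B)=\mathcal D(A)\cap\mathcal D(B)$) generate strongly continuous analytic semigroups $e^{tA}$, $e^{tB}$, $e^{t(A+B)}$, and $e^{tA}e^{tB}=e^{tB}e^{tA}$ for $t\ge 0$. Put $\varphi_\ell(\tau A)x=\frac{1}{(\ell-1)!}\int_0^1\theta^{\ell-1}e^{(1-\theta)\tau A}x\,d\theta$ for $\ell\ge1$, and likewise for $B$. Let $Y$ be a Banach space of ($\mu$-a.e. classes of) functions $\Omega\to\mathbb C$ on a measure space $(\Omega,\mu)$, in which norm limits and a.e. limits of sequences agree (for instance $L^p(\mu)$, or a space of continuous functions with the supremum norm). For a measurable $q:\Omega\to\mathbb R$ let $M_q y=qy$ with domain $\{y\in Y: qy\in Y\}$, and assume $\|M_q\|\le\|q\|_\infty$ for all such $q$, that is, $\|qy\|\le\|q\|_\infty\|y\|$ for $y\in\mathcal D(M_q)$. Assume that there are a bounded bijective linear operator $V:X\to Y$ with bounded inverse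 and measurable functions $q_A,q_B:\Omega\to(-\infty,0]$ with $$A=V^{-1}M_{q_A}V,\qquad B=V^{-1}M_{q_B}V .$$ Let $g:X\to X$ be twice Fr\'echet differentiable (over $\mathbb R$) with uniformly bounded first and second derivatives, and let $u\in C^3([0,T];X)$ satisfy $u(t)\in\mathcal D(A+B)$ and $$u'(t)=(A+B)u(t)+g(u(t))=:f(u(t)),\qquad t\in(0,T].$$ Assume finally that $g(u(t))-g(u(s))\in\mathcal D(BA)$ for all $0\le t,s\le T$. \textbf{Theorem.} For every step size $\tau>0$ the scheme ERK2 $$U_{n2}=u_n+\tau\varphi_1(\tau A)\varphi_1(\tau B)f(u_n),\qquad u_{n+1}=U_{n2}+2\tau\varphi_2(\tau A)\varphi_2(\tau B)\bigl(g(U_{n2})-g(u_n)\bigr),$$ with $u_0=u(0)$, is well defined (all $u_n$ lie in $\mathcal D(A+B)$), and it converges with order two: $$\|u_n-u(n\tau)\|\le C\tau^2,\qquad 0\le n\tau\le T .$$ The constant $C$ is independent of $n$ and $\tau$ and of the stiffness of the problem: it depends only on $T$, on an upper bound for $\|V\|\,\|V^{-1}\|$, on a bound for the first and second derivatives of $g$,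 and on a bound for $\|u'\|,\|u''\|,\|u'''\|$ on $[0,T]$. -/

import Mathlib

open Set Filter Topology MeasureTheory

noncomputable section

namespace SplitExp

/-- A strongly continuous semigroup `(S t)_{t ≥ 0}` of bounded operators on `X`. Only the values at
`t ≥ 0` are meaningful. -/
structure C0Semigroup (X : Type*) [NormedAddCommGroup X] [NormedSpace ℂ X] where
  op : ℝ → X →L[ℂ] X
  op_zero : op 0 = ContinuousLinearMap.id ℂ X
  op_add : ∀ s t : ℝ, 0 ≤ s → 0 ≤ t → op (s + t) = (op s).comp (op t)
  tendsto_zero : ∀ x : X, Tendsto (fun t : ℝ => op t x) (𝓝[>] 0) (𝓝 x)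

/-- The open sector `{z ≠ 0 : |arg z| < δ}`. -/
def sector (δ : ℝ) : Set ℂ := {z | z ≠ 0 ∧ |z.arg| < δ}

namespace C0Semigroup

variable {X : Type*} [NormedAddCommGroup X] [NormedSpace ℂ X]

/-- `A` is the (infinitesimal) generator of the semigroup: `x ∈ D(A)` and `A x = y` if and only if
`(S h x - x) / h → y` as `h → 0+`. -/
def IsGenerator (S : C0Semigroup X) (A : X →ₗ.[ℂ] X) : Prop :=
  ∀ x y : X, (x, y) ∈ A.graph ↔
    Tendsto (fun h : ℝ => h⁻¹ • (S.op h x - x)) (𝓝[>] 0) (𝓝 y)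

/-- The semigroup is analytic: it extends to a holomorphic semigroup on an open sector around the
positive real axis, strongly continuous at the origin in every smaller sector. -/
def IsAnalytic (S : C0Semigroup X) : Prop :=
  ∃ δ : ℝ, 0 < δ ∧ δ ≤ Real.pi / 2 ∧ ∃ F : ℂ → X →L[ℂ] X,
    (∀ t : ℝ, 0 < t → F (t : ℂ) = S.op t) ∧
    DifferentiableOn ℂ F (sector δ) ∧
    (∀ z ∈ sector δ, ∀ w ∈ sector δ, F (z + w) = (F z).comp (F w)) ∧
    ∀ δ' : ℝ, 0 < δ' → δ' < δ → ∀ x : X,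
      Tendsto (fun z => F z x) (𝓝[sector δ'] 0) (𝓝 x)

/-- `S` is an analytic semigroup and `A` is its generator. -/
def IsAnalyticGeneratedBy (S : C0Semigroup X) (A : X →ₗ.[ℂ] X) : Prop :=
  S.IsGenerator A ∧ S.IsAnalytic

/-- `φ_ℓ(τ A) x`, where `A` is the generator of `S` and `τ ≥ 0`: `φ_0(τ A) = e^{τ A}` and
`φ_ℓ(τ A) x = 1/(ℓ-1)! ∫_0^1 θ^(ℓ-1) e^{(1-θ) τ A} x dθ` for `ℓ ≥ 1`. -/
def phi (S : C0Semigroup X) : ℕ → ℝ → X → X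
  | 0, τ, x => S.op τ x
  | k + 1, τ, x => ((k.factorial : ℝ)⁻¹) • ∫ θ in (0 : ℝ)..1, (θ ^ k) • S.op ((1 - θ) * τ) x

end C0Semigroup

/-- A realization of the normed space `Y` as a space of (`μ`-a.e. classes of) functions `Ω → ℂ`, in
which norm limits and a.e. pointwise limits agree. Examples: `L^p(μ)`; spaces of
continuous functions with the supremum norm (take `μ` the counting measure on all subsets). -/
structure FunctionSpace (Y : Type*) [NormedAddCommGroup Y] [NormedSpace ℂ Y]
    {Ω : Type*} [MeasurableSpace Ω] (μ : Measure Ω) where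
  toFun : Y →ₗ[ℂ] (Ω →ₘ[μ] ℂ)
  injective : Function.Injective toFun
  limit_eq : ∀ (y : ℕ → Y) (y₀ : Y) (f : Ω → ℂ), Tendsto y atTop (𝓝 y₀) →
    (∀ᵐ ω ∂μ, Tendsto (fun n => toFun (y n) ω) atTop (𝓝 (f ω))) → toFun y₀ =ᵐ[μ] f

namespace FunctionSpace

variable {Y : Type*} [NormedAddCommGroup Y] [NormedSpace ℂ Y]
  {Ω : Type*} [MeasurableSpace Ω] {μ : Measure Ω}

/-- The graph `{(y, z) : z = q y}` of multiplication by `q`. -/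
def mulGraph (J : FunctionSpace Y μ) (q : Ω → ℝ) : Submodule ℂ (Y × Y) where
  carrier := {p | J.toFun p.2 =ᵐ[μ] fun ω => (q ω : ℂ) * J.toFun p.1 ω}
  zero_mem' := by
    simp only [mem_ofPred_eq, Prod.fst_zero, Prod.snd_zero, map_zero]
    filter_upwards [AEEqFun.coeFn_zero (α := Ω) (μ := μ) (β := ℂ)] with ω h
    simp [h]
  add_mem' := by
    intro a b ha hb
    simp only [mem_ofPred_eq, Prod.fst_add, Prod.snd_add, map_add] at *
    filter_upwards [ha, hb, AEEqFun.coeFn_add (J.toFun a.1) (J.toFun b.1),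
      AEEqFun.coeFn_add (J.toFun a.2) (J.toFun b.2)] with ω h1 h2 h3 h4
    simp only [Pi.add_apply] at h3 h4
    rw [h3, h4, h1, h2, mul_add]
  smul_mem' := by
    intro c a ha
    simp only [mem_ofPred_eq, Prod.smul_fst, Prod.smul_snd, map_smul] at *
    filter_upwards [ha, AEEqFun.coeFn_smul c (J.toFun a.1),
      AEEqFun.coeFn_smul c (J.toFun a.2)] with ω h1 h3 h4
    simp only [Pi.smul_apply, smul_eq_mul] at h3 h4
    rw [h3, h4, h1]
    ring

/-- The multiplication operator `M_q y = q y` with its natural domain `{y ∈ Y : q y ∈ Y}`. -/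
def mulOp (J : FunctionSpace Y μ) (q : Ω → ℝ) : Y →ₗ.[ℂ] Y := (J.mulGraph q).toLinearPMap

theorem mem_graph_mulOp (J : FunctionSpace Y μ) (q : Ω → ℝ) (y z : Y) :
    (y, z) ∈ (J.mulOp q).graph ↔ J.toFun z =ᵐ[μ] fun ω => (q ω : ℂ) * J.toFun y ω := by
  rw [mulOp, Submodule.toLinearPMap_graph_eq]
  · rfl
  · rintro ⟨a, b⟩ h h0
    have h0' : a = 0 := h0
    subst h0'
    apply J.injective
    rw [map_zero]
    refine AEEqFun.ext (EventuallyEq.trans h ?_)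
    simp only [map_zero]
    filter_upwards [AEEqFun.coeFn_zero (α := Ω) (μ := μ) (β := ℂ)] with ω h
    simp [h]

/-- `‖M_q‖ ≤ ‖q‖_∞` for all multiplication operators on `Y`, where `‖q‖_∞ ∈ [0, ∞]` is the essential
supremum of `|q|`. -/
def MulNormLE (J : FunctionSpace Y μ) : Prop :=
  ∀ q : Ω → ℝ, AEStronglyMeasurable q μ → ∀ y : (J.mulOp q).domain,
    ‖J.mulOp q y‖ₑ ≤ eLpNorm q ⊤ μ * ‖(y : Y)‖ₑ

end FunctionSpace

section

variable {X Y : Type*} [NormedAddCommGroup X] [NormedSpace ℂ X]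
  [NormedAddCommGroup Y] [NormedSpace ℂ Y]

/-- The operator `V⁻¹ M V` with domain `{x : V x ∈ D(M)}`. -/
def conjOp (V : X ≃L[ℂ] Y) (M : Y →ₗ.[ℂ] Y) : X →ₗ.[ℂ] X where
  domain := M.domain.comap (V : X →ₗ[ℂ] Y)
  toFun :=
    { toFun := fun x => V.symm (M ⟨V (x : X), x.2⟩)
      map_add' := by
        intro x y
        rw [← map_add, ← M.map_add]
        congr 2
        ext
        simp
      map_smul' := by
        intro c x
        rw [RingHom.id_apply, ← map_smul, ← M.map_smul]
        congr 2
        ext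
        simp }

/-- The domain of the product `B A`: those `x ∈ D(A)` with `A x ∈ D(B)`. -/
def domProd (B A : X →ₗ.[ℂ] X) : Set X :=
  {x | ∃ hx : x ∈ A.domain, A ⟨x, hx⟩ ∈ B.domain}

/-- `u` solves `u'(t) = L u(t) + g (u(t))` for `t ∈ (0, T]` (one-sided derivative at `T`); in
particular `u(t) ∈ D(L)` for these `t`. -/
def IsSolution (L : X →ₗ.[ℂ] X) (g : X → X) (T : ℝ) (u : ℝ → X) : Prop :=
  ∀ t ∈ Ioc (0 : ℝ) T, ∃ h : u t ∈ L.domain,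
    HasDerivWithinAt u (L ⟨u t, h⟩ + g (u t)) (Icc 0 T) t

/-- `y` is obtained from `x` by one step of size `τ` of the scheme ERK2
`U = x + τ φ_1(τ A) φ_1(τ B) f(x)`, `y = U + 2 τ φ_2(τ A) φ_2(τ B) (g(U) - g(x))`, with
`f(x) = (A + B) x + g(x)`. It requires `x ∈ D(A + B)`. Here `SA`, `SB` are the semigroups generated
by `A`, `B`. -/
def IsERK2Step (A B : X →ₗ.[ℂ] X) (SA SB : C0Semigroup X) (g : X → X) (τ : ℝ) (x y : X) : Prop :=
  ∃ hx : x ∈ (A + B).domain,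
    let U := x + τ • SA.phi 1 τ (SB.phi 1 τ ((A + B) ⟨x, hx⟩ + g x))
    y = U + (2 * τ) • SA.phi 2 τ (SB.phi 2 τ (g U - g x))

end

end SplitExp

end

/-!
Stiffness-independent second-order convergence of ERK2 rests on a bounded functional calculus. Write
`a = -q_A`, `b = -q_B`. Every bounded continuous function `F` on the quadrant `[0, ∞)²` acts on `X`
by multiplication with `F(a, b)`, with norm at most `κ ‖F‖_∞` (`exists_joint_calculus`). That such a
product stays in the function space is not among the assumptions. It holds for the resolvents
`lam / (lam + a)` and `lam / (lam + b)`, because `lam - A` and `lam - B` are onto for large `lam`;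
by Stone–Weierstrass it holds for continuous functions of the two resolvents; and since the
resolvents have dense range, cutting off near infinity does no harm. In this calculus
`e^{tA}` is `e^{-t a}` (`op_eq_expSymbol`), the operators `φ_ℓ(τA)` are the expected functions
(`phi_eq_phiSymbol`), and an unbounded operator such as `A + B` is handled through its resolvent
`1 / (1 + a + b)`.

The linear part of the scheme is the stability operator `R` with symbol
`r = 1 - φ₁(-τa) φ₁(-τb) τ(a + b)`. As `r ∈ [-1, 1]`, all powers of `R` are bounded by `κ`. Let
`w = (g ∘ u)'`. The equations `u'' = (A + B) u' + w` and `u''' = (A + B) u'' + w'` trade each factor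
`τ(a + b)` in the local error for a factor `τ` times a bounded quantity, and what remains is
`τ² (χ - 2 φ₂(-τa) φ₂(-τb)) w + O(τ³)` with `χ = (1 - φ₁(-τa) φ₁(-τb)) / (τ(a + b))`.
The coefficient of `τ² w` does not vanish, but it is bounded by `3 (1 - r)` (`abs_quotFun_sub_le`),
so it equals `(1 - R) Ψ` up to `O(τ)`, with `‖Ψ‖ ≤ 3 κ`. The error `e_n` of the scheme, corrected to
`e_n + τ² Ψ w(nτ)`, then satisfies a recursion with `R` and perturbations
`O(τ) ‖e_n‖ + O(τ³)`, and a discrete Gronwall argument finishes the proof (`convergence`).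
-/

/-! ### Analytic semigroups and their generators -/

namespace SplitExp

namespace C0Semigroup

variable {X : Type*} [NormedAddCommGroup X] [NormedSpace ℂ X]

theorem sector_mem_nhds {δ t : ℝ} (hδ : 0 < δ) (ht : 0 < t) : sector δ ∈ 𝓝 (t : ℂ) := by
  have h1 : ContinuousAt Complex.arg (t : ℂ) :=
    Complex.continuousAt_arg (Complex.ofReal_mem_slitPlane.2 ht)
  have h2 : ContinuousAt (fun z : ℂ => |z.arg|) (t : ℂ) := h1.abs
  have h3 : |(t : ℂ).arg| < δ := by simpa [Complex.arg_ofReal_of_nonneg ht.le] using hδ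
  filter_upwards [h2.eventually_lt_const h3,
    isOpen_ne.mem_nhds (show (t : ℂ) ≠ 0 by exact_mod_cast ht.ne')] with z hz hz0
  exact ⟨hz0, hz⟩

/-- An analytic semigroup is differentiable in operator norm at positive times. -/
theorem IsAnalytic.differentiableAt {S : C0Semigroup X} (h : S.IsAnalytic) {t : ℝ} (ht : 0 < t) :
    DifferentiableAt ℝ S.op t := by
  obtain ⟨δ, hδ, -, F, hF, hd, -, -⟩ := h
  have h1 : DifferentiableAt ℂ F (t : ℂ) := hd.differentiableAt (sector_mem_nhds hδ ht)
  have h2 : DifferentiableAt ℝ (fun s : ℝ => F (s : ℂ)) t :=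
    (h1.restrictScalars ℝ).comp t Complex.ofRealCLM.differentiableAt
  refine h2.congr_of_eventuallyEq ?_
  filter_upwards [lt_mem_nhds ht] with s hs using (hF s hs).symm

theorem hasDerivAt_op_apply {L : ℝ → X →L[ℂ] X} {L' : X →L[ℂ] X} {t : ℝ} (h : HasDerivAt L L' t)
    (x : X) : HasDerivAt (fun s => L s x) (L' x) t :=
  ((ContinuousLinearMap.apply ℂ X x).restrictScalars ℝ).hasFDerivAt.comp_hasDerivAt t h

/-- The orbits, extended to negative times by reflection, are continuous. -/
theorem IsAnalytic.continuous_orbit {S : C0Semigroup X} (h : S.IsAnalytic) (x : X) :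
    Continuous fun t : ℝ => S.op |t| x := by
  have hc : ContinuousOn (fun t : ℝ => S.op t x) (Ici 0) := by
    intro t ht
    rcases (mem_Ici.1 ht).eq_or_lt with rfl | ht
    · rw [← continuousWithinAt_Ioi_iff_Ici]
      simpa [ContinuousWithinAt, S.op_zero] using S.tendsto_zero x
    · exact (hasDerivAt_op_apply
        (h.differentiableAt ht).hasDerivAt x).continuousAt.continuousWithinAt
  exact hc.comp_continuous continuous_abs fun t => abs_nonneg t

variable {S : C0Semigroup X} {A : X →ₗ.[ℂ] X}

/-- The derivative at a positive time is `A e^{tA}`. -/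
theorem IsAnalyticGeneratedBy.deriv_mem_graph (h : S.IsAnalyticGeneratedBy A) {t : ℝ} (ht : 0 < t)
    (x : X) : (S.op t x, deriv S.op t x) ∈ A.graph := by
  rw [h.1]
  have h1 := hasDerivAt_op_apply (h.2.differentiableAt ht).hasDerivAt x
  have h2 := (hasDerivAt_iff_tendsto_slope_zero.1 h1).mono_left
    (nhdsWithin_mono 0 (fun y (hy : (0 : ℝ) < y) => hy.ne') : 𝓝[>] (0 : ℝ) ≤ 𝓝[≠] 0)
  refine h2.congr' ?_
  filter_upwards [self_mem_nhdsWithin] with s hs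
  rw [add_comm t s, S.op_add s t (le_of_lt hs) ht.le]
  rfl

variable [CompleteSpace X]

/-- The truncated Laplace transform of an orbit lies in the domain of the generator. -/
theorem IsAnalyticGeneratedBy.integral_mem_graph (h : S.IsAnalyticGeneratedBy A) (c : ℝ)
    (hc : 0 ≤ c) (lam : ℝ) (y : X) :
    (∫ t in (0 : ℝ)..c, Real.exp (-lam * t) • S.op |t| y,
      lam • (∫ t in (0 : ℝ)..c, Real.exp (-lam * t) • S.op |t| y)
        - (y - Real.exp (-lam * c) • S.op c y)) ∈ A.graph := by
  rw [h.1]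
  set k : ℝ → X := fun t => Real.exp (-lam * t) • S.op |t| y with hk
  have hkc : Continuous k := (by fun_prop : Continuous fun t : ℝ => Real.exp (-lam * t)).smul
    (h.2.continuous_orbit y)
  set I : ℝ → X := fun r => ∫ t in (0 : ℝ)..r, k t with hI
  have hI' : ∀ r, HasDerivAt I (k r) r := fun r =>
    intervalIntegral.integral_hasDerivAt_right (hkc.intervalIntegrable _ _)
      (hkc.stronglyMeasurableAtFilter _ _) hkc.continuousAt
  -- `S h` shifts the integral, up to the factor `e^{lam h}`
  have hshift : ∀ s : ℝ, 0 < s → S.op s (I c) = Real.exp (lam * s) • (I (c + s) - I s) := by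
    intro s hs
    have e1 : I (c + s) - I s = ∫ t in s..(c + s), k t :=
      intervalIntegral.integral_interval_sub_left (hkc.intervalIntegrable _ _)
        (hkc.intervalIntegrable _ _)
    have e2 : ∫ t in s..(c + s), k t = ∫ t in (0 : ℝ)..c, k (t + s) := by
      rw [intervalIntegral.integral_comp_add_right (fun t => k t), zero_add]
    rw [e1, e2, ← intervalIntegral.integral_smul]
    have e3 : S.op s (I c) = ∫ t in (0 : ℝ)..c, S.op s (k t) :=
      ((S.op s).intervalIntegral_comp_comm (hkc.intervalIntegrable _ _)).symm
    rw [e3]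
    refine intervalIntegral.integral_congr fun t ht => ?_
    rw [uIcc_of_le hc] at ht
    have ht0 : 0 ≤ t := ht.1
    simp only [hk]
    rw [abs_of_nonneg ht0, abs_of_nonneg (by positivity : 0 ≤ t + s), smul_smul, ← Real.exp_add,
      add_comm t s, S.op_add s t hs.le ht0, ContinuousLinearMap.comp_apply,
      ContinuousLinearMap.map_smul_of_tower]
    congr 2
    ring
  have hd : HasDerivAt (fun s : ℝ => Real.exp (lam * s) • (I (c + s) - I s))
      (lam • I c - (y - Real.exp (-lam * c) • S.op c y)) 0 := by
    have d1 : HasDerivAt (fun s : ℝ => Real.exp (lam * s)) lam 0 := by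
      have := ((hasDerivAt_id (0 : ℝ)).const_mul lam).exp
      simpa using this
    have d2 : HasDerivAt (fun s : ℝ => I (c + s) - I s) (k c - k 0) 0 := by
      have h1 : HasDerivAt (fun s : ℝ => I (c + s)) (k c) 0 := by
        have := hI' (c + 0)
        rw [add_zero] at this
        exact HasDerivAt.comp_const_add c 0 (by rwa [add_zero])
      exact h1.sub (hI' 0)
    have := d1.smul d2
    have hI0 : I 0 = 0 := intervalIntegral.integral_same
    refine this.congr_deriv ?_
    have hk0 : k 0 = y := by simp [hk, S.op_zero]
    have hkc' : k c = Real.exp (-lam * c) • S.op c y := by simp only [hk, abs_of_nonneg hc]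
    rw [hk0, hkc', hI0, mul_zero, Real.exp_zero, one_smul, add_zero, sub_zero]
    abel
  have h2 := (hasDerivAt_iff_tendsto_slope_zero.1 hd).mono_left
    (nhdsWithin_mono 0 (fun y (hy : (0 : ℝ) < y) => hy.ne') : 𝓝[>] (0 : ℝ) ≤ 𝓝[≠] 0)
  refine h2.congr' ?_
  filter_upwards [self_mem_nhdsWithin] with s hs
  have hI0 : I 0 = 0 := intervalIntegral.integral_same
  change _ = s⁻¹ • (S.op s (I c) - I c)
  rw [zero_add, hshift s hs]
  simp [hI0]

/-- The generator is densely defined: `x` is the limit of the means of its orbit. -/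
theorem IsAnalyticGeneratedBy.dense_domain (h : S.IsAnalyticGeneratedBy A) (x : X) {ε : ℝ}
    (hε : 0 < ε) : ∃ p ∈ A.graph, ‖p.1 - x‖ < ε := by
  have hkc := h.2.continuous_orbit x
  have hd : HasDerivAt (fun r : ℝ => ∫ t in (0 : ℝ)..r, S.op |t| x) (S.op |0| x) 0 :=
    intervalIntegral.integral_hasDerivAt_right (hkc.intervalIntegrable _ _)
      (hkc.stronglyMeasurableAtFilter _ _) hkc.continuousAt
  have h2 := (hasDerivAt_iff_tendsto_slope_zero.1 hd).mono_left
    (nhdsWithin_mono 0 (fun y (hy : (0 : ℝ) < y) => hy.ne') : 𝓝[>] (0 : ℝ) ≤ 𝓝[≠] 0)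
  simp only [abs_zero, S.op_zero, zero_add, intervalIntegral.integral_same, sub_zero,
    ContinuousLinearMap.id_apply] at h2
  obtain ⟨c, hc, hc0⟩ := ((Metric.tendsto_nhds.1 h2 ε hε).and self_mem_nhdsWithin).exists
  have h3 := h.integral_mem_graph c (le_of_lt hc0) 0 x
  simp only [neg_zero, zero_mul, Real.exp_zero, one_smul] at h3
  refine ⟨_, A.graph.smul_mem ((c⁻¹ : ℝ) : ℂ) h3, ?_⟩
  rw [← dist_eq_norm]
  rw [Complex.coe_smul]
  exact hc

/-- `lam - A` is onto for all large real `lam`: the truncated Laplace transform inverts it up to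
the invertible operator `1 - e^{-lam} e^{A}`. -/
theorem IsAnalyticGeneratedBy.exists_resolvent (h : S.IsAnalyticGeneratedBy A) :
    ∃ lam₀ : ℝ, ∀ lam ≥ lam₀, ∀ y : X, ∃ x : X, (x, (lam : ℂ) • x - y) ∈ A.graph := by
  have ht : Tendsto (fun lam : ℝ => Real.exp (-lam) * ‖S.op 1‖) atTop (𝓝 (0 * ‖S.op 1‖)) :=
    (Real.tendsto_exp_neg_atTop_nhds_zero).mul_const _
  rw [zero_mul] at ht
  obtain ⟨lam₀, h₀⟩ := eventually_atTop.1 (ht.eventually_lt_const (zero_lt_one' ℝ))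
  refine ⟨lam₀, fun lam hlam y => ?_⟩
  have hlt : ‖((Real.exp (-lam) : ℝ) : ℂ) • S.op 1‖ < 1 := by
    rw [norm_smul, Complex.norm_real, Real.norm_of_nonneg (Real.exp_pos _).le]
    exact h₀ lam hlam
  obtain ⟨U, hU⟩ := isUnit_one_sub_of_norm_lt_one hlt
  set z : X := (↑U⁻¹ : X →L[ℂ] X) y
  have hz : z - Real.exp (-lam) • S.op 1 z = y := by
    have h1 : (↑U * ↑U⁻¹ : X →L[ℂ] X) y = y := by rw [Units.mul_inv]; rfl
    rw [hU] at h1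
    rw [← Complex.coe_smul]
    exact h1
  have h3 := h.integral_mem_graph 1 zero_le_one lam z
  rw [mul_one, hz] at h3
  exact ⟨_, by simpa using h3⟩

end C0Semigroup

/-! ### Multipliers of a function space -/

namespace FunctionSpace

variable {Y : Type*} [NormedAddCommGroup Y] [NormedSpace ℂ Y]
  {Ω : Type*} [MeasurableSpace Ω] {μ : Measure Ω} {J : FunctionSpace Y μ}

theorem mem_mulGraph {m : Ω → ℝ} {y z : Y} :
    (y, z) ∈ J.mulGraph m ↔ J.toFun z =ᵐ[μ] fun ω => (m ω : ℂ) * J.toFun y ω := Iff.rfl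

theorem mulGraph_unique {m : Ω → ℝ} {y z z' : Y} (h : (y, z) ∈ J.mulGraph m)
    (h' : (y, z') ∈ J.mulGraph m) : z = z' :=
  J.injective (AEEqFun.ext (EventuallyEq.trans h (EventuallyEq.symm h')))

theorem mulGraph_mul {m m' : Ω → ℝ} {y z w : Y} (h : (y, z) ∈ J.mulGraph m)
    (h' : (z, w) ∈ J.mulGraph m') : (y, w) ∈ J.mulGraph fun ω => m' ω * m ω := by
  rw [mem_mulGraph] at *
  filter_upwards [h, h'] with ω h1 h2
  rw [h2, h1]
  push_cast
  ring

/-- Cancellation: if `z = m y` and `w = m' m y`, then `w = m' z`. -/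
theorem mulGraph_of_mul {m m' : Ω → ℝ} {y z w : Y}
    (h : (y, w) ∈ J.mulGraph fun ω => m' ω * m ω) (h' : (y, z) ∈ J.mulGraph m) :
    (z, w) ∈ J.mulGraph m' := by
  rw [mem_mulGraph] at *
  filter_upwards [h, h'] with ω h1 h2
  rw [h1, h2]
  push_cast
  ring

theorem mulGraph_add {m m' : Ω → ℝ} {y z z' : Y} (h : (y, z) ∈ J.mulGraph m)
    (h' : (y, z') ∈ J.mulGraph m') : (y, z + z') ∈ J.mulGraph fun ω => m ω + m' ω := by
  rw [mem_mulGraph] at *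
  rw [map_add]
  filter_upwards [h, h', AEEqFun.coeFn_add (J.toFun z) (J.toFun z')] with ω h1 h2 h3
  rw [h3, Pi.add_apply, h1, h2]
  push_cast
  ring

theorem mulGraph_const (c : ℝ) (y : Y) : (y, (c : ℂ) • y) ∈ J.mulGraph fun _ => c := by
  rw [mem_mulGraph, map_smul]
  filter_upwards [AEEqFun.coeFn_smul (c : ℂ) (J.toFun y)] with ω h
  simpa using h

theorem mulGraph_one (y : Y) : (y, y) ∈ J.mulGraph fun _ => 1 := by
  simpa using mulGraph_const (J := J) 1 y

theorem eq_zero_of_mulGraph {m : Ω → ℝ} (hm : ∀ ω, m ω ≠ 0) {y : Y}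
    (h : (y, 0) ∈ J.mulGraph m) : y = 0 := by
  have h1 : (y, y) ∈ J.mulGraph fun ω => (m ω)⁻¹ * m ω := by
    simpa [inv_mul_cancel₀ (hm _)] using mulGraph_one (J := J) y
  have h2 : ((0 : Y), y) ∈ J.mulGraph fun ω => (m ω)⁻¹ := mulGraph_of_mul h1 h
  exact mulGraph_unique h2 (J.mulGraph _).zero_mem

/-- The norm bound for multiplication operators, for a bound that holds everywhere. -/
theorem norm_le_of_mulGraph (hJ : J.MulNormLE) {m : Ω → ℝ} (hm : AEStronglyMeasurable m μ) {c : ℝ}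
    (hc : 0 ≤ c) (hmc : ∀ ω, |m ω| ≤ c) {y z : Y} (h : (y, z) ∈ J.mulGraph m) :
    ‖z‖ ≤ c * ‖y‖ := by
  have h1 : (y, z) ∈ (J.mulOp m).graph := (J.mem_graph_mulOp m y z).2 h
  obtain ⟨y', hy', hz'⟩ := (LinearPMap.mem_graph_iff _).1 h1
  have h2 := hJ m hm y'
  have h3 : eLpNorm m ⊤ μ ≤ ENNReal.ofReal c := by
    rw [eLpNorm_exponent_top]
    exact eLpNormEssSup_le_of_ae_bound (ae_of_all _ hmc)
  simp only at hy' hz'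
  rw [hz', hy'] at h2
  have h4 : ENNReal.ofReal ‖z‖ ≤ ENNReal.ofReal (c * ‖y‖) := by
    rw [ENNReal.ofReal_mul hc, ofReal_norm, ofReal_norm]
    exact h2.trans (by gcongr)
  exact (ENNReal.ofReal_le_ofReal_iff (by positivity)).1 h4

/-- Norm limits of products are products with the pointwise limit. -/
theorem mulGraph_of_tendsto {m : ℕ → Ω → ℝ} {m₀ : Ω → ℝ} {y : Y} {z : ℕ → Y} {z₀ : Y}
    (h : ∀ n, (y, z n) ∈ J.mulGraph (m n)) (hz : Tendsto z atTop (𝓝 z₀))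
    (hm : ∀ ω, Tendsto (fun n => m n ω) atTop (𝓝 (m₀ ω))) : (y, z₀) ∈ J.mulGraph m₀ := by
  refine J.limit_eq z z₀ _ hz ?_
  filter_upwards [ae_all_iff.2 fun n => mem_mulGraph.1 (h n)] with ω hω
  simp only [hω]
  exact ((Complex.continuous_ofReal.tendsto _).comp (hm ω)).mul_const _

/-- `m` is a multiplier of `J`: the product `m y` lies in the space for every `y`. -/
def IsMultiplier (J : FunctionSpace Y μ) (m : Ω → ℝ) : Prop := ∀ y, ∃ z, (y, z) ∈ J.mulGraph m

theorem IsMultiplier.const (c : ℝ) : J.IsMultiplier fun _ => c := fun y => ⟨_, mulGraph_const c y⟩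

theorem IsMultiplier.add {m m' : Ω → ℝ} (h : J.IsMultiplier m) (h' : J.IsMultiplier m') :
    J.IsMultiplier fun ω => m ω + m' ω := fun y =>
  ⟨_, mulGraph_add (h y).choose_spec (h' y).choose_spec⟩

theorem IsMultiplier.mul {m m' : Ω → ℝ} (h : J.IsMultiplier m) (h' : J.IsMultiplier m') :
    J.IsMultiplier fun ω => m' ω * m ω := fun y =>
  ⟨_, mulGraph_mul (h y).choose_spec (h' _).choose_spec⟩

theorem mulGraph_sub {m m' : Ω → ℝ} {y z z' : Y} (h : (y, z) ∈ J.mulGraph m)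
    (h' : (y, z') ∈ J.mulGraph m') : (y, z - z') ∈ J.mulGraph fun ω => m ω - m' ω := by
  have h1 := mulGraph_add h (mulGraph_mul h' (mulGraph_const (-1) z'))
  simpa [sub_eq_add_neg] using h1

variable [CompleteSpace Y]

/-- Uniform limits of multipliers are multipliers. -/
theorem IsMultiplier.of_uniform_limit (hJ : J.MulNormLE) {m : ℕ → Ω → ℝ} {m₀ : Ω → ℝ} {ε : ℕ → ℝ}
    (hmeas : ∀ n, AEStronglyMeasurable (m n) μ) (h : ∀ n, J.IsMultiplier (m n))
    (hε : Tendsto ε atTop (𝓝 0)) (hm : ∀ n ω, |m n ω - m₀ ω| ≤ ε n) : J.IsMultiplier m₀ := by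
  intro y
  choose z hz using fun n => h n y
  have hdist : ∀ n k, ‖z n - z k‖ ≤ (|ε n| + |ε k|) * ‖y‖ := fun n k => by
    refine norm_le_of_mulGraph hJ ((hmeas n).sub (hmeas k)) (by positivity) (fun ω => ?_)
      (mulGraph_sub (hz n) (hz k))
    have h1 := abs_le.1 ((hm n ω).trans (le_abs_self _))
    have h2 := abs_le.1 ((hm k ω).trans (le_abs_self _))
    rw [Pi.sub_apply, abs_le]
    constructor <;> linarith
  have hb : Tendsto (fun p : ℕ × ℕ => (|ε p.1| + |ε p.2|) * ‖y‖) (atTop ×ˢ atTop) (𝓝 0) := by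
    have h0 : Tendsto (fun n => |ε n|) atTop (𝓝 0) := by simpa using hε.abs
    simpa using ((h0.comp tendsto_fst).add (h0.comp tendsto_snd)).mul_const ‖y‖
  have hcau : CauchySeq z := by
    rw [cauchySeq_iff_tendsto_dist_atTop_0, ← prod_atTop_atTop_eq]
    exact squeeze_zero (fun _ => dist_nonneg) (fun p => by rw [dist_eq_norm]; exact hdist _ _) hb
  obtain ⟨z₀, hz₀⟩ := cauchySeq_tendsto_of_complete hcau
  refine ⟨z₀, mulGraph_of_tendsto hz hz₀ fun ω => ?_⟩
  rw [tendsto_iff_norm_sub_tendsto_zero]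
  exact squeeze_zero (fun _ => norm_nonneg _) (fun n => hm n ω) hε

/-- By the Stone–Weierstrass theorem, continuous functions of two multipliers with values in
`[0, 1]` are multipliers. -/
theorem isMultiplier_comp_continuousMap (hJ : J.MulNormLE) {p : Ω → unitInterval × unitInterval}
    (hp : AEStronglyMeasurable p μ) (h1 : J.IsMultiplier fun ω => ((p ω).1 : ℝ))
    (h2 : J.IsMultiplier fun ω => ((p ω).2 : ℝ)) (G : C(unitInterval × unitInterval, ℝ)) :
    J.IsMultiplier fun ω => G (p ω) := by
  let N : Subalgebra ℝ C(unitInterval × unitInterval, ℝ) :=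
    { carrier := {G | J.IsMultiplier fun ω => G (p ω)}
      mul_mem' := fun {a b} ha hb => by simpa [mul_comm] using ha.mul hb
      add_mem' := fun {a b} ha hb => ha.add hb
      algebraMap_mem' := fun r => IsMultiplier.const r }
  have hsep : N.SeparatesPoints := by
    intro a b hab
    by_cases h : a.1 = b.1
    · refine ⟨_, ⟨⟨fun q => (q.2 : ℝ), by fun_prop⟩, h2, rfl⟩, fun h' => hab (Prod.ext h ?_)⟩
      exact Subtype.ext h'
    · refine ⟨_, ⟨⟨fun q => (q.1 : ℝ), by fun_prop⟩, h1, rfl⟩, fun h' => h ?_⟩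
      exact Subtype.ext h'
  have htop := ContinuousMap.subalgebra_topologicalClosure_eq_top_of_separatesPoints N hsep
  have hG : G ∈ closure (N : Set C(unitInterval × unitInterval, ℝ)) := by
    rw [← Subalgebra.topologicalClosure_coe, htop]
    trivial
  obtain ⟨F, hF, hlim⟩ := mem_closure_iff_seq_limit.1 hG
  refine IsMultiplier.of_uniform_limit hJ (fun n => (F n).continuous.comp_aestronglyMeasurable hp)
    hF (tendsto_iff_norm_sub_tendsto_zero.1 hlim) fun n ω => ?_
  exact (F n - G).norm_coe_le_norm (p ω)

end FunctionSpace

/-! ### Bounded continuous functions of the symbols are multipliers -/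

/-- The set `[0, ∞)²` of values of `(-q_A, -q_B)`. -/
abbrev Quadrant : Type := NNReal × NNReal

/-- A bounded continuous function on the quadrant, written in the variables `lam / (lam + a)` and
`lam / (lam + b)` and cut off near infinity. It extends continuously to the closed square. -/
noncomputable def cutoffMap (lam : ℝ) (F : BoundedContinuousFunction Quadrant ℝ) (n : ℕ) :
    C(unitInterval × unitInterval, ℝ) where
  toFun p := F ((lam / p.1 - lam).toNNReal, (lam / p.2 - lam).toNNReal) *
    min 1 (n * ((p.1 : ℝ) * p.2))
  continuous_toFun := by
    rw [continuous_iff_continuousAt]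
    rintro ⟨x, y⟩
    have hmin : Continuous fun p : unitInterval × unitInterval =>
        min 1 ((n : ℝ) * ((p.1 : ℝ) * p.2)) := by fun_prop
    by_cases h : (x : ℝ) * y = 0
    · have h0 : Tendsto (fun p : unitInterval × unitInterval =>
          ‖F‖ * min 1 ((n : ℝ) * ((p.1 : ℝ) * p.2))) (𝓝 (x, y)) (𝓝 0) := by
        have := (hmin.const_mul ‖F‖).tendsto (x, y)
        simpa [h] using this
      simp only [ContinuousAt, h, mul_zero, min_eq_right zero_le_one]
      refine squeeze_zero_norm (fun p => ?_) h0
      have hp : 0 ≤ min 1 ((n : ℝ) * ((p.1 : ℝ) * p.2)) :=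
        le_min zero_le_one (mul_nonneg n.cast_nonneg (mul_nonneg p.1.2.1 p.2.2.1))
      rw [norm_mul, Real.norm_of_nonneg hp]
      exact mul_le_mul_of_nonneg_right (F.norm_coe_le_norm _) hp
    · refine ContinuousAt.mul ?_ hmin.continuousAt
      refine F.continuous.continuousAt.comp (f := fun p : unitInterval × unitInterval =>
        ((lam / p.1 - lam).toNNReal, (lam / p.2 - lam).toNNReal)) ?_
      have hx : (x : ℝ) ≠ 0 := left_ne_zero_of_mul h
      have hy : (y : ℝ) ≠ 0 := right_ne_zero_of_mul h
      refine ContinuousAt.prodMk ?_ ?_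
      · have h1 : ContinuousAt (fun p : unitInterval × unitInterval => lam / (p.1 : ℝ) - lam)
            (x, y) :=
          (continuousAt_const.div
            (by fun_prop : Continuous fun p : unitInterval × unitInterval =>
              (p.1 : ℝ)).continuousAt hx).sub continuousAt_const
        exact continuous_real_toNNReal.continuousAt.comp h1
      · have h2 : ContinuousAt (fun p : unitInterval × unitInterval => lam / (p.2 : ℝ) - lam)
            (x, y) :=
          (continuousAt_const.div
            (by fun_prop : Continuous fun p : unitInterval × unitInterval =>
              (p.2 : ℝ)).continuousAt hy).sub continuousAt_const
        exact continuous_real_toNNReal.continuousAt.comp h2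

/-- The value `lam / (lam + a)` as a point of the unit interval. -/
noncomputable def resolventPoint (lam : ℝ) (hlam : 0 < lam) (a : NNReal) : unitInterval :=
  ⟨lam / (lam + a), by positivity, div_le_one_of_le₀ (by simp) (by positivity)⟩

theorem continuous_resolventPoint (lam : ℝ) (hlam : 0 < lam) :
    Continuous (resolventPoint lam hlam) := by
  refine Continuous.subtype_mk (Continuous.div continuous_const (by fun_prop) fun a => ?_) _
  positivity

theorem toNNReal_resolventPoint (lam : ℝ) (hlam : 0 < lam) (a : NNReal) :
    (lam / resolventPoint lam hlam a - lam).toNNReal = a := by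
  have : lam / (resolventPoint lam hlam a : ℝ) - lam = a := by
    have h1 : lam + (a : ℝ) ≠ 0 := by positivity
    simp only [resolventPoint]
    field_simp
    ring
  rw [this, Real.toNNReal_coe]

namespace FunctionSpace

variable {Y : Type*} [NormedAddCommGroup Y] [NormedSpace ℂ Y]
  {Ω : Type*} [MeasurableSpace Ω] {μ : Measure Ω} {J : FunctionSpace Y μ}

/-- The resolvent multiplier `lam / (lam + a)` exists on the whole space and has dense range. -/
def HasDenseResolvent (J : FunctionSpace Y μ) (lam : ℝ) (a : Ω → NNReal) : Prop :=
  J.IsMultiplier (fun ω => lam / (lam + a ω)) ∧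
    ∀ y : Y, ∀ ε > 0, ∃ z z', (z, z') ∈ J.mulGraph (fun ω => lam / (lam + a ω)) ∧ ‖z' - y‖ < ε

/-- The product of the two resolvent multipliers has dense range. -/
theorem dense_range_mul (hJ : J.MulNormLE) {lam : ℝ} (hlam : 0 < lam) {a b : Ω → NNReal}
    (ha : AEStronglyMeasurable a μ) (hA : J.HasDenseResolvent lam a)
    (hB : J.HasDenseResolvent lam b) (y : Y) {ε : ℝ} (hε : 0 < ε) :
    ∃ z z', (z, z') ∈ J.mulGraph (fun ω => lam / (lam + a ω) * (lam / (lam + b ω))) ∧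
      ‖z' - y‖ < ε := by
  obtain ⟨z, z', hz, hz'⟩ := hA.2 y (ε / 2) (by positivity)
  obtain ⟨v, v', hv, hv'⟩ := hB.2 z (ε / 2) (by positivity)
  obtain ⟨v'', hv''⟩ := hA.1 v'
  refine ⟨v, v'', mulGraph_mul hv hv'', ?_⟩
  have h1 : ‖v'' - z'‖ ≤ 1 * ‖v' - z‖ := by
    refine norm_le_of_mulGraph hJ ?_ zero_le_one (fun ω => ?_) ((J.mulGraph _).sub_mem hv'' hz)
    · exact (continuous_subtype_val.comp
        (continuous_resolventPoint lam hlam)).comp_aestronglyMeasurable ha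
    · have := (resolventPoint lam hlam (a ω)).2
      exact abs_le.2 ⟨by linarith [this.1, show lam / (lam + a ω) =
        (resolventPoint lam hlam (a ω) : ℝ) from rfl], this.2⟩
  calc ‖v'' - y‖ = ‖(v'' - z') + (z' - y)‖ := by rw [sub_add_sub_cancel]
    _ ≤ ‖v'' - z'‖ + ‖z' - y‖ := norm_add_le _ _
    _ < ε := by linarith

variable [CompleteSpace Y]

/-- Every bounded continuous function of the symbols `a`, `b` is a multiplier. Cut off near
infinity it is a continuous function of the resolvent multipliers, and the cutoffs converge
strongly to the identity because the resolvents have dense range. -/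
theorem isMultiplier_comp (hJ : J.MulNormLE) {lam : ℝ} (hlam : 0 < lam) {a b : Ω → NNReal}
    (ha : AEStronglyMeasurable a μ) (hb : AEStronglyMeasurable b μ)
    (hA : J.HasDenseResolvent lam a) (hB : J.HasDenseResolvent lam b)
    (F : BoundedContinuousFunction Quadrant ℝ) : J.IsMultiplier fun ω => F (a ω, b ω) := by
  set p : Ω → unitInterval × unitInterval := fun ω =>
    (resolventPoint lam hlam (a ω), resolventPoint lam hlam (b ω)) with hp
  have hpm : AEStronglyMeasurable p μ :=
    ((continuous_resolventPoint lam hlam).comp_aestronglyMeasurable ha).prodMk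
      ((continuous_resolventPoint lam hlam).comp_aestronglyMeasurable hb)
  set s : Ω → ℝ := fun ω => lam / (lam + a ω) * (lam / (lam + b ω)) with hs
  have hs0 : ∀ ω, 0 < s ω := fun ω => by positivity
  have hsm : AEStronglyMeasurable s μ :=
    (by fun_prop : Continuous fun q : unitInterval × unitInterval =>
      (q.1 : ℝ) * q.2).comp_aestronglyMeasurable hpm
  have hmult := isMultiplier_comp_continuousMap hJ hpm hA.1 hB.1
  have hcut : ∀ (F : BoundedContinuousFunction Quadrant ℝ) (n : ℕ),
      J.IsMultiplier fun ω => F (a ω, b ω) * min 1 (n * s ω) := fun F n => by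
    have h1 := hmult (cutoffMap lam F n)
    simp only [cutoffMap, ContinuousMap.coe_mk, hp, toNNReal_resolventPoint] at h1
    exact h1
  set e : ℕ → Ω → ℝ := fun n ω => min 1 (n * s ω) with he
  have he0 : ∀ n ω, 0 ≤ e n ω := fun n ω => le_min zero_le_one (by have := hs0 ω; positivity)
  have he1 : ∀ n ω, e n ω ≤ 1 := fun n ω => min_le_left _ _
  have hem : ∀ n, AEStronglyMeasurable (e n) μ := fun n =>
    (by fun_prop : Continuous fun x : ℝ => min 1 ((n : ℝ) * x)).comp_aestronglyMeasurable hsm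
  have heM : ∀ n, J.IsMultiplier (e n) := fun n => by
    simpa using hcut (BoundedContinuousFunction.const _ 1) n
  have helim : ∀ ω, Tendsto (fun n => e n ω) atTop (𝓝 1) := fun ω => by
    refine tendsto_const_nhds.congr' ?_
    have := (tendsto_natCast_atTop_atTop (R := ℝ)).atTop_mul_const (hs0 ω)
    filter_upwards [this.eventually_ge_atTop 1] with n hn using (min_eq_left hn).symm
  intro y
  choose Ey hEy using fun n => heM n y
  have hstrong : Tendsto Ey atTop (𝓝 y) := by
    rw [Metric.tendsto_atTop]
    intro ε hε
    obtain ⟨z, z', hz, hz'⟩ := dense_range_mul hJ hlam ha hA hB y (show 0 < ε / 3 by positivity)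
    obtain ⟨n₀, hn₀⟩ := exists_nat_gt (‖z‖ / (ε / 3))
    refine ⟨n₀ + 1, fun n hn => ?_⟩
    obtain ⟨w, hw⟩ := heM n z'
    have hn0 : (0 : ℝ) < n := by exact_mod_cast (by omega : 0 < n)
    have h1 : ‖Ey n - w‖ ≤ 1 * ‖y - z'‖ :=
      norm_le_of_mulGraph hJ (hem n) zero_le_one
        (fun ω => abs_le.2 ⟨by linarith [he0 n ω], he1 n ω⟩) ((J.mulGraph _).sub_mem (hEy n) hw)
    -- on the range of `s` the cutoff error is at most `1 / n`
    have h2 : ‖w - z'‖ ≤ (n : ℝ)⁻¹ * ‖z‖ := by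
      refine norm_le_of_mulGraph hJ (((hem n).mul hsm).sub hsm) (by positivity) (fun ω => ?_)
        (mulGraph_sub (mulGraph_mul hz hw) hz)
      simp only [Pi.sub_apply, Pi.mul_apply]
      have h3 : e n ω * s ω - s ω = -((1 - e n ω) * s ω) := by ring
      change |e n ω * s ω - s ω| ≤ _
      rw [h3, abs_neg, abs_of_nonneg (mul_nonneg (by linarith [he1 n ω]) (hs0 ω).le)]
      rcases le_total 1 (n * s ω) with h4 | h4
      · simp only [he, min_eq_left h4]
        simp
      · have h5 : s ω ≤ (n : ℝ)⁻¹ := by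
          rw [le_inv_comm₀ (hs0 ω) hn0, ← one_div, le_div_iff₀ (hs0 ω)]
          exact h4
        nlinarith [he0 n ω, hs0 ω]
    have h6 : (n : ℝ)⁻¹ * ‖z‖ < ε / 3 := by
      rw [inv_mul_lt_iff₀ hn0]
      rw [div_lt_iff₀ (by positivity)] at hn₀
      have : (n₀ : ℝ) ≤ n := by exact_mod_cast (by omega : n₀ ≤ n)
      nlinarith
    rw [dist_eq_norm]
    calc ‖Ey n - y‖ = ‖(Ey n - w) + ((w - z') + (z' - y))‖ := by congr 1; abel
      _ ≤ ‖Ey n - w‖ + (‖w - z'‖ + ‖z' - y‖) :=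
        (norm_add_le _ _).trans (add_le_add_right (norm_add_le _ _) _)
      _ < ε := by
        rw [norm_sub_rev y z'] at h1
        linarith
  choose z hz using fun n => hcut F n y
  -- `F e_n y - F e_k y = F (e_n y - e_k y)`, whence the products form a Cauchy sequence
  have hFm : AEStronglyMeasurable (fun ω => F (a ω, b ω)) μ :=
    F.continuous.comp_aestronglyMeasurable (ha.prodMk hb)
  have hdist : ∀ n k, dist (z n) (z k) ≤ ‖F‖ * dist (Ey n) (Ey k) := fun n k => by
    rw [dist_eq_norm, dist_eq_norm]
    exact norm_le_of_mulGraph hJ hFm (norm_nonneg F) (fun ω => F.norm_coe_le_norm _)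
      ((J.mulGraph _).sub_mem (mulGraph_of_mul (hz n) (hEy n)) (mulGraph_of_mul (hz k) (hEy k)))
  have hcau : CauchySeq z := by
    rw [cauchySeq_iff_tendsto_dist_atTop_0]
    have h0 := (cauchySeq_iff_tendsto_dist_atTop_0.1 hstrong.cauchySeq).const_mul ‖F‖
    rw [mul_zero] at h0
    exact squeeze_zero (fun _ => dist_nonneg) (fun p => hdist _ _) h0
  obtain ⟨z₀, hz₀⟩ := cauchySeq_tendsto_of_complete hcau
  refine ⟨z₀, mulGraph_of_tendsto hz hz₀ fun ω => ?_⟩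
  simpa using (helim ω).const_mul (F (a ω, b ω))

end FunctionSpace

/-! ### The joint functional calculus -/

open scoped BoundedContinuousFunction

section Symbols

variable {Q : Type*} [TopologicalSpace Q]

/-- The symbol `1 / (1 + l)` of the resolvent at `1` of the operator with symbol `-l`. -/
noncomputable def invSymbol (l : C(Q, NNReal)) : Q →ᵇ ℝ :=
  BoundedContinuousFunction.ofNormedAddCommGroup (fun q => (1 + (l q : ℝ))⁻¹)
    (Continuous.inv₀ (by fun_prop) fun q => by positivity) 1 fun q => by
      rw [Real.norm_of_nonneg (by positivity)]
      exact inv_le_one_of_one_le₀ (by simp)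

@[simp] theorem invSymbol_apply (l : C(Q, NNReal)) (q : Q) :
    invSymbol l q = (1 + (l q : ℝ))⁻¹ := rfl

/-- In the functional calculus `Φ`, the (possibly unbounded) operator `A` has the symbol `-l`; this
is expressed through the resolvent of `A` at `1`. -/
def HasSymbol {X : Type*} [NormedAddCommGroup X] [NormedSpace ℂ X]
    (Φ : (Q →ᵇ ℝ) →ₐ[ℝ] (X →L[ℂ] X)) (A : X →ₗ.[ℂ] X) (l : C(Q, NNReal)) : Prop :=
  ∀ x y : X, (x, y) ∈ A.graph ↔ Φ (invSymbol l) (x - y) = x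

/-- The function `fst`, minus the symbol of `A`. -/
def symbolA : C(Quadrant, NNReal) := ⟨Prod.fst, continuous_fst⟩

/-- The function `snd`, minus the symbol of `B`. -/
def symbolB : C(Quadrant, NNReal) := ⟨Prod.snd, continuous_snd⟩

end Symbols

section Construction

variable {X Y : Type*} [NormedAddCommGroup X] [NormedSpace ℂ X]
  [NormedAddCommGroup Y] [NormedSpace ℂ Y]
  {Ω : Type*} [MeasurableSpace Ω] {μ : Measure Ω} {J : FunctionSpace Y μ}

theorem mem_graph_conjOp (V : X ≃L[ℂ] Y) (M : Y →ₗ.[ℂ] Y) (x y : X) :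
    (x, y) ∈ (conjOp V M).graph ↔ (V x, V y) ∈ M.graph := by
  rw [LinearPMap.mem_graph_iff, LinearPMap.mem_graph_iff]
  constructor
  · rintro ⟨w, hw, hw'⟩
    simp only at hw hw'
    refine ⟨⟨V (w : X), w.2⟩, by simp [hw], ?_⟩
    rw [← hw']
    exact (V.apply_symm_apply _).symm
  · rintro ⟨w, hw, hw'⟩
    simp only at hw hw'
    have hx : V x ∈ M.domain := hw ▸ w.2
    have hw2 : w = ⟨V x, hx⟩ := Subtype.ext hw
    refine ⟨⟨x, hx⟩, rfl, ?_⟩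
    change V.symm (M ⟨V x, hx⟩) = y
    rw [← hw2, hw', V.symm_apply_apply]

theorem mem_graph_add_iff (A B : X →ₗ.[ℂ] X) (x y : X) :
    (x, y) ∈ (A + B).graph ↔
      ∃ y₁ y₂, (x, y₁) ∈ A.graph ∧ (x, y₂) ∈ B.graph ∧ y = y₁ + y₂ := by
  simp only [LinearPMap.mem_graph_iff]
  constructor
  · rintro ⟨w, hw, hw'⟩
    refine ⟨_, _, ⟨⟨(w : X), w.2.1⟩, hw, rfl⟩, ⟨⟨(w : X), w.2.2⟩, hw, rfl⟩, ?_⟩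
    rw [← hw', LinearPMap.add_apply]
  · rintro ⟨y₁, y₂, ⟨w, hw, hw'⟩, ⟨v, hv, hv'⟩, rfl⟩
    have hvw : (v : X) ∈ A.domain := by rw [hv, ← hw]; exact w.2
    have hwv : (w : X) ∈ B.domain := by rw [hw, ← hv]; exact v.2
    have e : (⟨(w : X), hwv⟩ : B.domain) = v := Subtype.ext (hw.trans hv.symm)
    refine ⟨⟨(w : X), w.2, hwv⟩, hw, ?_⟩
    rw [LinearPMap.add_apply, ← hw', ← hv', ← e]

open FunctionSpace

/-- If every bounded continuous function composed with `p` is a multiplier, then multiplication,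
transported by `V`, is a bounded functional calculus. -/
theorem exists_calculus {Q : Type*} [TopologicalSpace Q] (hJ : J.MulNormLE) (V : X ≃L[ℂ] Y)
    {p : Ω → Q} (hp : AEStronglyMeasurable p μ)
    (h : ∀ F : Q →ᵇ ℝ, J.IsMultiplier fun ω => F (p ω)) :
    ∃ Φ : (Q →ᵇ ℝ) →ₐ[ℝ] (X →L[ℂ] X),
      (∀ F x, (V x, V (Φ F x)) ∈ J.mulGraph fun ω => F (p ω)) ∧
      ∀ F, ‖Φ F‖ ≤ ‖(V : X →L[ℂ] Y)‖ * ‖(V.symm : Y →L[ℂ] X)‖ * ‖F‖ := by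
  choose m hm using h
  have huniq : ∀ (F : Q →ᵇ ℝ) (x z : X), (V x, V z) ∈ J.mulGraph (fun ω => F (p ω)) →
      V.symm (m F (V x)) = z := fun F x z hz => by
    rw [mulGraph_unique (hm F (V x)) hz, V.symm_apply_apply]
  have hmV : ∀ F x, (V x, V (V.symm (m F (V x)))) ∈ J.mulGraph (fun ω => F (p ω)) := fun F x => by
    rw [V.apply_symm_apply]
    exact hm F (V x)
  have hbound : ∀ (F : Q →ᵇ ℝ) (x : X), ‖V.symm (m F (V x))‖ ≤
      ‖(V : X →L[ℂ] Y)‖ * ‖(V.symm : Y →L[ℂ] X)‖ * ‖F‖ * ‖x‖ := fun F x => by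
    have h1 : ‖m F (V x)‖ ≤ ‖F‖ * ‖V x‖ :=
      norm_le_of_mulGraph hJ (F.continuous.comp_aestronglyMeasurable hp) (norm_nonneg F)
        (fun ω => F.norm_coe_le_norm _) (hm F (V x))
    have h2 : ‖V.symm (m F (V x))‖ ≤ ‖(V.symm : Y →L[ℂ] X)‖ * ‖m F (V x)‖ :=
      (V.symm : Y →L[ℂ] X).le_opNorm _
    have h3 : ‖V x‖ ≤ ‖(V : X →L[ℂ] Y)‖ * ‖x‖ := (V : X →L[ℂ] Y).le_opNorm _
    calc _ ≤ ‖(V.symm : Y →L[ℂ] X)‖ * (‖F‖ * (‖(V : X →L[ℂ] Y)‖ * ‖x‖)) :=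
          h2.trans (by gcongr; exact h1.trans (by gcongr))
      _ = _ := by ring
  let T : (Q →ᵇ ℝ) → (X →L[ℂ] X) := fun F =>
    LinearMap.mkContinuous
      { toFun := fun x => V.symm (m F (V x))
        map_add' := fun x y => huniq F _ _ (by
          rw [map_add, map_add]
          exact (J.mulGraph _).add_mem (hmV F x) (hmV F y))
        map_smul' := fun c x => huniq F _ _ (by
          rw [map_smul, map_smul]
          exact (J.mulGraph _).smul_mem c (hmV F x)) }
      (‖(V : X →L[ℂ] Y)‖ * ‖(V.symm : Y →L[ℂ] X)‖ * ‖F‖) (hbound F)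
  have hT : ∀ F x, (V x, V (T F x)) ∈ J.mulGraph fun ω => F (p ω) := hmV
  have hTu : ∀ (F : Q →ᵇ ℝ) (x z : X), (V x, V z) ∈ J.mulGraph (fun ω => F (p ω)) →
      T F x = z := huniq
  have hconst : ∀ (r : ℝ) x, T (algebraMap ℝ (Q →ᵇ ℝ) r) x = (r : ℂ) • x := fun r x =>
    hTu _ _ _ (by
      rw [map_smul]
      exact mulGraph_const r (V x))
  refine ⟨
    { toFun := T
      map_one' := ?_
      map_mul' := fun F G => ?_
      map_zero' := ?_
      map_add' := fun F G => ?_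
      commutes' := fun r => ?_ }, hT, fun F =>
    ContinuousLinearMap.opNorm_le_bound _ (by positivity) (hbound F)⟩
  · ext x
    exact hTu _ _ _ (mulGraph_one (V x))
  · ext x
    exact hTu _ _ _ (mulGraph_mul (hT G x) (hT F _))
  · ext x
    refine hTu _ _ _ ?_
    have := mulGraph_const (J := J) 0 (V x)
    simpa using this
  · ext x
    refine hTu _ _ _ ?_
    rw [add_apply, map_add]
    exact mulGraph_add (hT F x) (hT G x)
  · ext x
    exact hconst r x

/-- Multiplication by the unbounded function `-l` is determined by its resolvent at `1`, which is a
value of the calculus. -/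
theorem mulGraph_neg_iff {Q : Type*} [TopologicalSpace Q] {V : X ≃L[ℂ] Y} {p : Ω → Q}
    {Φ : (Q →ᵇ ℝ) →ₐ[ℝ] (X →L[ℂ] X)}
    (hΦ : ∀ F x, (V x, V (Φ F x)) ∈ J.mulGraph fun ω => F (p ω)) (l : C(Q, NNReal)) (x y : X) :
    (V x, V y) ∈ J.mulGraph (fun ω => -(l (p ω) : ℝ)) ↔ Φ (invSymbol l) (x - y) = x := by
  have hne : ∀ ω, (1 + (l (p ω) : ℝ)) ≠ 0 := fun ω => by positivity
  constructor
  · intro h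
    have h1 : (V x, V (x - y)) ∈ J.mulGraph fun ω => 1 + (l (p ω) : ℝ) := by
      rw [map_sub]
      simpa using mulGraph_sub (mulGraph_one (V x)) h
    have h2 : (V x, V x) ∈ J.mulGraph fun ω => invSymbol l (p ω) * (1 + (l (p ω) : ℝ)) := by
      simpa [inv_mul_cancel₀ (hne _)] using mulGraph_one (J := J) (V x)
    exact V.injective (mulGraph_unique (hΦ _ _) (mulGraph_of_mul h2 h1))
  · intro h
    have h1 := hΦ (invSymbol l) (x - y)
    rw [h] at h1
    have h2 : (V (x - y), V (x - y)) ∈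
        J.mulGraph fun ω => (1 + (l (p ω) : ℝ)) * invSymbol l (p ω) := by
      simpa [mul_inv_cancel₀ (hne _)] using mulGraph_one (J := J) (V (x - y))
    have h3 := mulGraph_sub (mulGraph_one (V x)) (mulGraph_of_mul h2 h1)
    simpa using h3

/-- The generator `A = V⁻¹ M_q V` of an analytic semigroup has, for all large `lam`, a resolvent
with dense range, and this resolvent is a multiplier. -/
theorem hasDenseResolvent [CompleteSpace X] {V : X ≃L[ℂ] Y} {A : X →ₗ.[ℂ] X} {S : C0Semigroup X}
    (hS : S.IsAnalyticGeneratedBy A) {q : Ω → ℝ} (hq : ∀ ω, q ω ≤ 0)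
    (hA : A = conjOp V (J.mulOp q)) :
    ∃ lam₀ : ℝ, ∀ lam ≥ lam₀, 0 < lam → J.HasDenseResolvent lam fun ω => (-q ω).toNNReal := by
  obtain ⟨lam₀, h₀⟩ := hS.exists_resolvent
  refine ⟨lam₀, fun lam hlam hpos => ?_⟩
  have hgraph : ∀ x y : X, (x, y) ∈ A.graph ↔ (V x, V y) ∈ J.mulGraph q := fun x y => by
    rw [hA, mem_graph_conjOp, mem_graph_mulOp, mem_mulGraph]
  have hcoe : ∀ ω, (((-q ω).toNNReal : NNReal) : ℝ) = -q ω := fun ω =>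
    Real.coe_toNNReal _ (by linarith [hq ω])
  have hne : ∀ ω, lam - q ω ≠ 0 := fun ω => by have := hq ω; intro h; linarith
  have hsub : ∀ x y : X, (x, y) ∈ A.graph →
      (V x, (lam : ℂ) • V x - V y) ∈ J.mulGraph fun ω => lam - q ω := fun x y hxy =>
    mulGraph_sub (mulGraph_const lam (V x)) ((hgraph x y).1 hxy)
  simp only [HasDenseResolvent, hcoe, ← sub_eq_add_neg]
  refine ⟨fun w => ?_, fun w ε hε => ?_⟩
  · obtain ⟨x, hx⟩ := h₀ lam hlam (V.symm w)
    have h1 := hsub _ _ hx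
    rw [map_sub, map_smul, V.apply_symm_apply, sub_sub_cancel] at h1
    refine ⟨(lam : ℂ) • V x, mulGraph_of_mul (m := fun ω => lam - q ω) ?_ h1⟩
    simpa [div_mul_cancel₀ _ (hne _)] using mulGraph_const (J := J) lam (V x)
  · obtain ⟨⟨x, y⟩, hx, hxw⟩ := hS.dense_domain (V.symm w)
      (show 0 < ε / (‖(V : X →L[ℂ] Y)‖ + 1) by positivity)
    rw [lt_div_iff₀ (by positivity)] at hxw
    have h1 := mulGraph_mul (hsub x y hx) (mulGraph_const lam⁻¹ _)
    refine ⟨_, V x, mulGraph_of_mul (m := fun ω => lam⁻¹ * (lam - q ω)) ?_ h1, ?_⟩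
    · have : ∀ ω, lam / (lam - q ω) * (lam⁻¹ * (lam - q ω)) = 1 := fun ω => by
        have := hne ω
        field_simp
      simpa only [this] using mulGraph_one (J := J) (V x)
    · have h2 : ‖V x - w‖ ≤ ‖(V : X →L[ℂ] Y)‖ * ‖x - V.symm w‖ := by
        have := (V : X →L[ℂ] Y).le_opNorm (x - V.symm w)
        simpa using this
      nlinarith [norm_nonneg (x - V.symm w)]

/-- The joint bounded functional calculus of two commuting multiplication operators: bounded
continuous functions on the quadrant act on `X`, and `A`, `B`, `A + B` have the expected symbols. -/
theorem exists_joint_calculus [CompleteSpace X] [CompleteSpace Y] (hJ : J.MulNormLE)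
    {V : X ≃L[ℂ] Y} {A B : X →ₗ.[ℂ] X} {SA SB : C0Semigroup X}
    (hSA : SA.IsAnalyticGeneratedBy A) (hSB : SB.IsAnalyticGeneratedBy B) {qA qB : Ω → ℝ}
    (hmA : AEStronglyMeasurable qA μ) (hmB : AEStronglyMeasurable qB μ)
    (hqA : ∀ ω, qA ω ≤ 0) (hqB : ∀ ω, qB ω ≤ 0)
    (hA : A = conjOp V (J.mulOp qA)) (hB : B = conjOp V (J.mulOp qB)) :
    ∃ Φ : (Quadrant →ᵇ ℝ) →ₐ[ℝ] (X →L[ℂ] X),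
      (∀ F, ‖Φ F‖ ≤ ‖(V : X →L[ℂ] Y)‖ * ‖(V.symm : Y →L[ℂ] X)‖ * ‖F‖) ∧
      (∀ F, (∀ q, F q ≠ 0) → ∀ x, Φ F x = 0 → x = 0) ∧
      HasSymbol Φ A symbolA ∧ HasSymbol Φ B symbolB ∧ HasSymbol Φ (A + B) (symbolA + symbolB) := by
  obtain ⟨l₁, h₁⟩ := hasDenseResolvent hSA hqA hA
  obtain ⟨l₂, h₂⟩ := hasDenseResolvent hSB hqB hB
  set lam := max 1 (max l₁ l₂) with hlam
  have hpos : 0 < lam := lt_of_lt_of_le one_pos (le_max_left _ _)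
  have hA' := h₁ lam ((le_max_left _ _).trans (le_max_right _ _)) hpos
  have hB' := h₂ lam ((le_max_right _ _).trans (le_max_right _ _)) hpos
  have ha : AEStronglyMeasurable (fun ω => (-qA ω).toNNReal) μ :=
    continuous_real_toNNReal.comp_aestronglyMeasurable hmA.neg
  have hb : AEStronglyMeasurable (fun ω => (-qB ω).toNNReal) μ :=
    continuous_real_toNNReal.comp_aestronglyMeasurable hmB.neg
  set p : Ω → Quadrant := fun ω => ((-qA ω).toNNReal, (-qB ω).toNNReal) with hp
  obtain ⟨Φ, hΦ, hnorm⟩ := exists_calculus hJ V (p := p) (ha.prodMk hb)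
    (isMultiplier_comp hJ hpos ha hb hA' hB')
  have hpA : ∀ ω, -(symbolA (p ω) : ℝ) = qA ω := fun ω => by
    change -(((-qA ω).toNNReal : NNReal) : ℝ) = qA ω
    rw [Real.coe_toNNReal _ (by linarith [hqA ω]), neg_neg]
  have hpB : ∀ ω, -(symbolB (p ω) : ℝ) = qB ω := fun ω => by
    change -(((-qB ω).toNNReal : NNReal) : ℝ) = qB ω
    rw [Real.coe_toNNReal _ (by linarith [hqB ω]), neg_neg]
  have hpAB : ∀ ω, -((symbolA + symbolB) (p ω) : ℝ) = qA ω + qB ω := fun ω => by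
    rw [← hpA, ← hpB, ContinuousMap.add_apply]
    push_cast
    ring
  have hgA : ∀ x y : X, (x, y) ∈ A.graph ↔ (V x, V y) ∈ J.mulGraph qA := fun x y => by
    rw [hA, mem_graph_conjOp, mem_graph_mulOp, mem_mulGraph]
  have hgB : ∀ x y : X, (x, y) ∈ B.graph ↔ (V x, V y) ∈ J.mulGraph qB := fun x y => by
    rw [hB, mem_graph_conjOp, mem_graph_mulOp, mem_mulGraph]
  refine ⟨Φ, hnorm, fun F hF x hx => ?_, fun x y => ?_, fun x y => ?_, fun x y => ?_⟩
  · have h1 := hΦ F x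
    rw [hx, map_zero] at h1
    exact V.map_eq_zero_iff.1 (eq_zero_of_mulGraph (fun ω => hF (p ω)) h1)
  · rw [← mulGraph_neg_iff hΦ, hgA]
    simp only [hpA]
  · rw [← mulGraph_neg_iff hΦ, hgB]
    simp only [hpB]
  · rw [← mulGraph_neg_iff hΦ, mem_graph_add_iff]
    simp only [hpAB]
    constructor
    · rintro ⟨y₁, y₂, h1, h2, rfl⟩
      rw [map_add]
      exact mulGraph_add ((hgA _ _).1 h1) ((hgB _ _).1 h2)
    · intro h
      -- `a / (1 + a + b)` is bounded, so `(a + b) V x ∈ Y` forces `a V x ∈ Y`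
      let F : Quadrant →ᵇ ℝ := BoundedContinuousFunction.ofNormedAddCommGroup
        (fun q => -(q.1 : ℝ) / (1 + q.1 + q.2))
        (Continuous.div (by fun_prop) (by fun_prop) fun q => by positivity) 1 fun q => by
          rw [neg_div, norm_neg, Real.norm_of_nonneg (by positivity)]
          refine div_le_one_of_le₀ ?_ (by positivity)
          have := q.2.2
          simp only [NNReal.val_eq_coe] at this
          linarith
      have h1 : (V x, V (x - y)) ∈ J.mulGraph fun ω => 1 - (qA ω + qB ω) := by
        rw [map_sub]
        exact mulGraph_sub (mulGraph_one (V x)) h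
      have h2 : (V x, V (Φ F (x - y))) ∈ J.mulGraph qA := by
        have h3 := mulGraph_mul h1 (hΦ F (x - y))
        have h4 : ∀ ω, F (p ω) * (1 - (qA ω + qB ω)) = qA ω := fun ω => by
          have e : F (p ω) = -(symbolA (p ω) : ℝ) / (1 + symbolA (p ω) + symbolB (p ω)) := rfl
          have e1 := hpA ω
          have e2 := hpB ω
          have e3 : 1 + (symbolA (p ω) : ℝ) + symbolB (p ω) ≠ 0 := by positivity
          rw [e, div_mul_eq_mul_div, div_eq_iff e3, ← e1, ← e2]
          ring
        simpa only [h4] using h3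
      refine ⟨Φ F (x - y), y - Φ F (x - y), (hgA _ _).2 h2, (hgB _ _).2 ?_, by abel⟩
      rw [map_sub]
      simpa using mulGraph_sub h h2

end Construction

/-! ### Semigroups and `φ`-functions in the functional calculus -/

theorem abs_exp_neg_sub_le {u v : ℝ} (hu : 0 ≤ u) (hv : 0 ≤ v) :
    |Real.exp (-u) - Real.exp (-v)| ≤ |u - v| := by
  wlog h : u ≤ v generalizing u v
  · rw [abs_sub_comm, abs_sub_comm u v]
    exact this hv hu (le_of_not_ge h)
  have h1 : Real.exp (-v) ≤ Real.exp (-u) := Real.exp_le_exp.2 (by linarith)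
  have h2 : Real.exp (-v) = Real.exp (-u) * Real.exp (u - v) := by
    rw [← Real.exp_add]
    ring_nf
  have h3 := Real.add_one_le_exp (u - v)
  have h4 : Real.exp (-u) ≤ 1 := Real.exp_le_one_iff.2 (by linarith)
  rw [abs_of_nonneg (by linarith), abs_of_nonpos (by linarith)]
  nlinarith [Real.exp_pos (-u)]

theorem abs_exp_neg_taylor_le {u v : ℝ} (hu : 0 ≤ u) (hv : 0 ≤ v) :
    |Real.exp (-v) - Real.exp (-u) + (v - u) * Real.exp (-u)| ≤ (v - u) ^ 2 := by
  have h0 : ∀ x y : ℝ, Real.exp (-x) * (1 + (x - y)) ≤ Real.exp (-y) := fun x y => by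
    have h2 : Real.exp (-y) = Real.exp (-x) * Real.exp (x - y) := by
      rw [← Real.exp_add]
      ring_nf
    rw [h2]
    exact mul_le_mul_of_nonneg_left (by linarith [Real.add_one_le_exp (x - y)])
      (Real.exp_pos _).le
  have h1 := h0 u v
  have h2 := h0 v u
  have h3 : (v - u) * (Real.exp (-u) - Real.exp (-v)) ≤ (v - u) ^ 2 := by
    refine (le_abs_self _).trans ?_
    rw [abs_mul, ← sq_abs, sq, abs_sub_comm v u]
    exact mul_le_mul_of_nonneg_left (abs_exp_neg_sub_le hu hv) (abs_nonneg _)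
  rw [abs_of_nonneg (by linarith)]
  linarith

section Symbols

variable {Q : Type*} [TopologicalSpace Q]

/-- The symbol `e^{-s l}` of the semigroup generated by the operator with symbol `-l`. Negative
times are replaced by `0`. -/
noncomputable def expSymbol (l : C(Q, NNReal)) (s : ℝ) : Q →ᵇ ℝ :=
  BoundedContinuousFunction.ofNormedAddCommGroup (fun q => Real.exp (-(max s 0 * l q)))
    (by fun_prop) 1 fun q => by
      rw [Real.norm_of_nonneg (Real.exp_pos _).le, Real.exp_le_one_iff]
      have : 0 ≤ max s 0 * (l q : ℝ) := mul_nonneg (le_max_right _ _) (l q).2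
      linarith

@[simp] theorem expSymbol_apply (l : C(Q, NNReal)) (s : ℝ) (q : Q) :
    expSymbol l s q = Real.exp (-(max s 0 * l q)) := rfl

/-- The regularized semigroup symbol `e^{-s l} (1 + l)⁻²`. Unlike `e^{-s l}`, it depends on `s`
continuously, and for `s > 0` differentiably, in the supremum norm. -/
noncomputable def regExpSymbol (l : C(Q, NNReal)) (s : ℝ) : Q →ᵇ ℝ :=
  expSymbol l s * (invSymbol l * invSymbol l)

theorem regExpSymbol_apply (l : C(Q, NNReal)) (s : ℝ) (q : Q) :
    regExpSymbol l s q =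
      Real.exp (-(max s 0 * l q)) * ((1 + (l q : ℝ))⁻¹ * (1 + (l q : ℝ))⁻¹) := rfl

theorem continuous_regExpSymbol (l : C(Q, NNReal)) : Continuous (regExpSymbol l) := by
  refine LipschitzWith.continuous (K := 1) (LipschitzWith.of_dist_le_mul fun s t => ?_)
  rw [NNReal.coe_one, one_mul]
  refine (BoundedContinuousFunction.dist_le dist_nonneg).2 fun q => ?_
  have hl : 0 ≤ (l q : ℝ) := (l q).2
  rw [Real.dist_eq, Real.dist_eq, regExpSymbol_apply, regExpSymbol_apply, ← sub_mul, abs_mul]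
  have h1 : |Real.exp (-(max s 0 * l q)) - Real.exp (-(max t 0 * l q))| ≤ |s - t| * l q := by
    refine (abs_exp_neg_sub_le (mul_nonneg (le_max_right _ _) hl)
      (mul_nonneg (le_max_right _ _) hl)).trans ?_
    rw [← sub_mul, abs_mul, abs_of_nonneg hl]
    exact mul_le_mul_of_nonneg_right (abs_max_sub_max_le_abs s t 0) hl
  have h2 : (l q : ℝ) * |(1 + (l q : ℝ))⁻¹ * (1 + (l q : ℝ))⁻¹| ≤ 1 := by
    rw [abs_of_nonneg (by positivity), ← mul_inv, ← div_eq_mul_inv]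
    exact div_le_one_of_le₀ (by nlinarith) (by positivity)
  calc _ ≤ |s - t| * l q * |(1 + (l q : ℝ))⁻¹ * (1 + (l q : ℝ))⁻¹| := by gcongr
    _ = |s - t| * (l q * |(1 + (l q : ℝ))⁻¹ * (1 + (l q : ℝ))⁻¹|) := by ring
    _ ≤ |s - t| := mul_le_of_le_one_right (abs_nonneg _) h2

theorem hasDerivAt_regExpSymbol (l : C(Q, NNReal)) {s : ℝ} (hs : 0 < s) :
    HasDerivAt (regExpSymbol l) (-(expSymbol l s * ((1 - invSymbol l) * invSymbol l))) s := by
  rw [hasDerivAt_iff_tendsto]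
  have h0 : Tendsto (fun t : ℝ => ‖t - s‖) (𝓝 s) (𝓝 0) :=
    tendsto_iff_norm_sub_tendsto_zero.1 tendsto_id
  refine squeeze_zero' (Eventually.of_forall fun t => by positivity) ?_ h0
  filter_upwards [lt_mem_nhds hs] with t ht
  have key : ‖regExpSymbol l t - regExpSymbol l s -
      (t - s) • (-(expSymbol l s * ((1 - invSymbol l) * invSymbol l)))‖ ≤ ‖t - s‖ ^ 2 := by
    refine (BoundedContinuousFunction.norm_le (by positivity)).2 fun q => ?_
    have hl : 0 ≤ (l q : ℝ) := (l q).2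
    have e : (regExpSymbol l t - regExpSymbol l s -
        (t - s) • (-(expSymbol l s * ((1 - invSymbol l) * invSymbol l)))) q =
        (Real.exp (-(t * l q)) - Real.exp (-(s * l q)) + (t * l q - s * l q) *
          Real.exp (-(s * l q))) * ((1 + (l q : ℝ))⁻¹ * (1 + (l q : ℝ))⁻¹) := by
      simp only [BoundedContinuousFunction.sub_apply, BoundedContinuousFunction.smul_apply,
        BoundedContinuousFunction.neg_apply, BoundedContinuousFunction.mul_apply,
        BoundedContinuousFunction.coe_one, Pi.one_apply, regExpSymbol_apply, expSymbol_apply,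
        invSymbol_apply, max_eq_left hs.le, max_eq_left ht.le, smul_eq_mul]
      field_simp
      ring
    rw [e, norm_mul, Real.norm_eq_abs, Real.norm_eq_abs, Real.norm_eq_abs,
      abs_of_nonneg (by positivity : 0 ≤ (1 + (l q : ℝ))⁻¹ * (1 + (l q : ℝ))⁻¹), sq_abs]
    have h1 := abs_exp_neg_taylor_le (mul_nonneg hs.le hl) (mul_nonneg ht.le hl)
    have h2 : (l q : ℝ) ^ 2 * ((1 + (l q : ℝ))⁻¹ * (1 + (l q : ℝ))⁻¹) ≤ 1 := by
      rw [← mul_inv, ← div_eq_mul_inv]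
      exact div_le_one_of_le₀ (by nlinarith) (by positivity)
    calc _ ≤ (t * l q - s * l q) ^ 2 * ((1 + (l q : ℝ))⁻¹ * (1 + (l q : ℝ))⁻¹) := by gcongr
      _ = (t - s) ^ 2 * ((l q : ℝ) ^ 2 * ((1 + (l q : ℝ))⁻¹ * (1 + (l q : ℝ))⁻¹)) := by ring
      _ ≤ (t - s) ^ 2 := mul_le_of_le_one_right (sq_nonneg _) h2
  rcases eq_or_ne ‖t - s‖ 0 with h | h
  · simp [h]
  · calc _ ≤ ‖t - s‖⁻¹ * ‖t - s‖ ^ 2 := by gcongr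
      _ = ‖t - s‖ := by field_simp

/-- The scalar function `φ_{k+1}(-s) = 1/k! ∫_0^1 θ^k e^{-(1-θ) s} dθ`. -/
noncomputable def phiFun (k : ℕ) (s : ℝ) : ℝ :=
  ((k.factorial : ℝ)⁻¹) * ∫ θ in (0 : ℝ)..1, θ ^ k * Real.exp (-((1 - θ) * s))

theorem continuous_phiFun (k : ℕ) : Continuous (phiFun k) := by
  refine continuous_const.mul ?_
  exact intervalIntegral.continuous_parametric_intervalIntegral_of_continuous'
    (f := fun s θ => θ ^ k * Real.exp (-((1 - θ) * s))) (by fun_prop) 0 1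

theorem phiFun_nonneg (k : ℕ) (s : ℝ) : 0 ≤ phiFun k s :=
  mul_nonneg (by positivity) (intervalIntegral.integral_nonneg zero_le_one fun θ hθ =>
    mul_nonneg (pow_nonneg hθ.1 _) (Real.exp_pos _).le)

theorem phiFun_le_one (k : ℕ) {s : ℝ} (hs : 0 ≤ s) : phiFun k s ≤ 1 := by
  have h1 : ∫ θ in (0 : ℝ)..1, θ ^ k * Real.exp (-((1 - θ) * s)) ≤ ∫ _ in (0 : ℝ)..1, (1 : ℝ) := by
    refine intervalIntegral.integral_mono_on zero_le_one
      (Continuous.intervalIntegrable (by fun_prop) _ _) (by simp) fun θ hθ => ?_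
    have h2 : Real.exp (-((1 - θ) * s)) ≤ 1 :=
      Real.exp_le_one_iff.2 (by nlinarith [hθ.2, mul_nonneg (sub_nonneg.2 hθ.2) hs])
    exact mul_le_one₀ (pow_le_one₀ hθ.1 hθ.2) (Real.exp_pos _).le h2
  rw [intervalIntegral.integral_const, sub_zero, one_smul] at h1
  have h3 : ((k.factorial : ℝ)⁻¹) ≤ 1 :=
    inv_le_one_of_one_le₀ (by exact_mod_cast k.factorial_pos)
  have h4 := phiFun_nonneg k s
  rw [phiFun] at *
  exact (mul_le_mul_of_nonneg_left h1 (by positivity)).trans (by simpa using h3)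

/-- The symbol of `φ_{k+1}` of the operator with symbol `-l`. -/
noncomputable def phiSymbol (k : ℕ) (l : C(Q, NNReal)) : Q →ᵇ ℝ :=
  BoundedContinuousFunction.ofNormedAddCommGroup (fun q => phiFun k (l q))
    ((continuous_phiFun k).comp (by fun_prop)) 1 fun q => by
      rw [Real.norm_of_nonneg (phiFun_nonneg _ _)]
      exact phiFun_le_one k (l q).2

@[simp] theorem phiSymbol_apply (k : ℕ) (l : C(Q, NNReal)) (q : Q) :
    phiSymbol k l q = phiFun k (l q) := rfl

/-- The `φ`-symbol as an integral of semigroup symbols. The regularizing factor makes the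
integrand continuous in the supremum norm, so that this is a Bochner integral. -/
theorem integral_regExpSymbol (k : ℕ) (l : C(Q, NNReal)) (τ : NNReal) :
    ((k.factorial : ℝ)⁻¹) • ∫ θ in (0 : ℝ)..1, (θ ^ k) • regExpSymbol l ((1 - θ) * τ) =
      invSymbol l * invSymbol l * phiSymbol k (τ • l) := by
  ext q
  have hc : Continuous fun θ : ℝ => (θ ^ k) • regExpSymbol l ((1 - θ) * τ) :=
    (by fun_prop : Continuous fun θ : ℝ => θ ^ k).smul
      ((continuous_regExpSymbol l).comp (by fun_prop))
  have h1 := (BoundedContinuousFunction.evalCLM ℝ q).intervalIntegral_comp_comm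
    (hc.intervalIntegrable (μ := volume) 0 1)
  simp only [BoundedContinuousFunction.evalCLM_apply] at h1
  rw [BoundedContinuousFunction.smul_apply, ← h1, BoundedContinuousFunction.mul_apply,
    BoundedContinuousFunction.mul_apply, phiSymbol_apply, invSymbol_apply, phiFun, smul_eq_mul,
    mul_left_comm]
  congr 1
  rw [← intervalIntegral.integral_const_mul]
  refine intervalIntegral.integral_congr fun θ hθ => ?_
  rw [uIcc_of_le zero_le_one] at hθ
  have h2 : 0 ≤ (1 - θ) * (τ : ℝ) := mul_nonneg (sub_nonneg.2 hθ.2) τ.2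
  simp only [BoundedContinuousFunction.smul_apply, regExpSymbol_apply, max_eq_left h2, smul_eq_mul,
    ContinuousMap.smul_apply, NNReal.coe_mul]
  rw [mul_assoc (1 - θ)]
  ring

end Symbols

section Identification

variable {X : Type*} [NormedAddCommGroup X] [NormedSpace ℂ X] {Q : Type*} [TopologicalSpace Q]
  {Φ : (Q →ᵇ ℝ) →ₐ[ℝ] (X →L[ℂ] X)} {κ : ℝ} {A : X →ₗ.[ℂ] X} {l : C(Q, NNReal)}
  {S : C0Semigroup X}

theorem calculus_mul_apply (Φ : (Q →ᵇ ℝ) →ₐ[ℝ] (X →L[ℂ] X)) (F G : Q →ᵇ ℝ) (x : X) :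
    Φ (F * G) x = Φ F (Φ G x) := by
  rw [map_mul]
  rfl

theorem calculus_add_apply (Φ : (Q →ᵇ ℝ) →ₐ[ℝ] (X →L[ℂ] X)) (F G : Q →ᵇ ℝ) (x : X) :
    Φ (F + G) x = Φ F x + Φ G x := by
  rw [map_add]
  rfl

theorem calculus_sub_apply (Φ : (Q →ᵇ ℝ) →ₐ[ℝ] (X →L[ℂ] X)) (F G : Q →ᵇ ℝ) (x : X) :
    Φ (F - G) x = Φ F x - Φ G x := by
  rw [map_sub]
  rfl

theorem calculus_smul_apply (Φ : (Q →ᵇ ℝ) →ₐ[ℝ] (X →L[ℂ] X)) (c : ℝ) (F : Q →ᵇ ℝ) (x : X) :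
    Φ (c • F) x = c • Φ F x := by
  rw [map_smul]
  rfl

theorem calculus_one_apply (Φ : (Q →ᵇ ℝ) →ₐ[ℝ] (X →L[ℂ] X)) (x : X) : Φ 1 x = x := by
  rw [map_one]
  rfl

/-- The semigroup generated by the operator with symbol `-l` is `e^{-t l}` in the functional
calculus: `s ↦ Φ(e^{-(t-s) l} (1 + l)⁻²) S(s)` has derivative zero. -/
theorem op_eq_expSymbol (hΦ : ∀ F, ‖Φ F‖ ≤ κ * ‖F‖)
    (hinj : ∀ F, (∀ q, F q ≠ 0) → ∀ x, Φ F x = 0 → x = 0) (hA : HasSymbol Φ A l)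
    (hS : S.IsAnalyticGeneratedBy A) {t : ℝ} (ht : 0 ≤ t) : S.op t = Φ (expSymbol l t) := by
  rcases ht.eq_or_lt with rfl | ht
  · have : expSymbol l 0 = 1 := by
      ext q
      simp
    rw [this, map_one, S.op_zero]
    rfl
  ext y
  let ΦL : (Q →ᵇ ℝ) →L[ℝ] (X →L[ℂ] X) := Φ.toLinearMap.mkContinuous κ hΦ
  let P : (Q →ᵇ ℝ) →L[ℝ] (X →L[ℝ] X) :=
    (ContinuousLinearMap.restrictScalarsL ℂ X X ℝ ℝ).comp ΦL
  have hP : ∀ F x, P F x = Φ F x := fun F x => rfl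
  set f : ℝ → X := fun c => P (regExpSymbol l (t - c)) (S.op |c| y) with hf
  have hfc : Continuous f :=
    (P.continuous.comp ((continuous_regExpSymbol l).comp (by fun_prop))).clm_apply
      (hS.2.continuous_orbit y)
  have hd : ∀ c ∈ Ioo 0 t, HasDerivAt f 0 c := by
    intro c hc
    have d1 : HasDerivAt (fun c => regExpSymbol l (t - c))
        (expSymbol l (t - c) * ((1 - invSymbol l) * invSymbol l)) c := by
      have h1 := (hasDerivAt_regExpSymbol l (sub_pos.2 hc.2)).scomp c
        ((hasDerivAt_id c).const_sub t)
      rw [neg_smul, one_smul, neg_neg] at h1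
      exact h1
    have d2 : HasDerivAt (fun c => S.op |c| y) (deriv S.op c y) c := by
      refine (C0Semigroup.hasDerivAt_op_apply
        (hS.2.differentiableAt hc.1).hasDerivAt y).congr_of_eventuallyEq ?_
      filter_upwards [lt_mem_nhds hc.1] with s hs
      rw [abs_of_pos hs]
    have d3 := (P.hasFDerivAt.comp_hasDerivAt c d1).clm_apply d2
    refine d3.congr_deriv ?_
    have hg := (hA _ _).1 (hS.deriv_mem_graph hc.1 y)
    rw [map_sub] at hg
    simp only [Function.comp_apply, hP, abs_of_pos hc.1, regExpSymbol, calculus_mul_apply,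
      calculus_sub_apply, calculus_one_apply]
    rw [← map_add]
    have e : ∀ z w : X, Φ (invSymbol l) z - Φ (invSymbol l) w = z →
        (Φ (invSymbol l) z - Φ (invSymbol l) (Φ (invSymbol l) z)) +
          Φ (invSymbol l) (Φ (invSymbol l) w) = 0 := fun z w h => by
      rw [sub_add, ← map_sub, h, sub_self]
    rw [e _ _ hg, map_zero]
  have hconst : ∀ c ∈ Ioo 0 t, f t = f c := fun c hc =>
    constant_of_has_deriv_right_zero hfc.continuousOn
      (fun s hs => (hd s ⟨hc.1.trans_le hs.1, hs.2⟩).hasDerivWithinAt) t ⟨hc.2.le, le_rfl⟩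
  have h0 : f t = f 0 := by
    have h1 : Tendsto f (𝓝[>] 0) (𝓝 (f 0)) := (hfc.tendsto 0).mono_left nhdsWithin_le_nhds
    refine tendsto_nhds_unique (tendsto_const_nhds.congr' ?_) h1
    filter_upwards [Ioo_mem_nhdsGT ht] with c hc using hconst c hc
  have h2 : Φ (invSymbol l * invSymbol l) (S.op t y - Φ (expSymbol l t) y) = 0 := by
    have e : expSymbol l 0 = 1 := by
      ext q
      simp
    simp only [hf, hP, sub_self, sub_zero, abs_of_pos ht, abs_zero, S.op_zero, regExpSymbol, e,
      one_mul, ContinuousLinearMap.id_apply] at h0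
    rw [map_sub, h0, mul_comm (expSymbol l t), calculus_mul_apply Φ _ (expSymbol l t), sub_self]
  refine sub_eq_zero.1 (hinj _ (fun q => ?_) _ h2)
  simp only [BoundedContinuousFunction.mul_apply, invSymbol_apply]
  positivity

variable [CompleteSpace X]

/-- The operators `φ_{k+1}(τA)` are given by their symbols. Both sides are compared after applying
the injective operator with symbol `(1 + l)⁻²`. -/
theorem phi_eq_phiSymbol (hΦ : ∀ F, ‖Φ F‖ ≤ κ * ‖F‖)
    (hinj : ∀ F, (∀ q, F q ≠ 0) → ∀ x, Φ F x = 0 → x = 0) (hA : HasSymbol Φ A l)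
    (hS : S.IsAnalyticGeneratedBy A) (k : ℕ) (τ : NNReal) (x : X) :
    S.phi (k + 1) τ x = Φ (phiSymbol k (τ • l)) x := by
  let ΦL : (Q →ᵇ ℝ) →L[ℝ] (X →L[ℂ] X) := Φ.toLinearMap.mkContinuous κ hΦ
  let E : (Q →ᵇ ℝ) →L[ℝ] X :=
    ((ContinuousLinearMap.apply ℂ X x).restrictScalars ℝ).comp ΦL
  have hE : ∀ F, E F = Φ F x := fun F => rfl
  let R : X →L[ℝ] X := (Φ (invSymbol l * invSymbol l)).restrictScalars ℝ
  have hR : ∀ z, R z = Φ (invSymbol l * invSymbol l) z := fun z => rfl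
  have hphi : S.phi (k + 1) τ x =
      ((k.factorial : ℝ)⁻¹) • ∫ θ in (0 : ℝ)..1, (θ ^ k) • S.op |(1 - θ) * τ| x := by
    rw [C0Semigroup.phi]
    congr 1
    refine intervalIntegral.integral_congr fun θ hθ => ?_
    rw [uIcc_of_le zero_le_one] at hθ
    simp only [abs_of_nonneg (mul_nonneg (sub_nonneg.2 hθ.2) τ.coe_nonneg)]
  have hc : Continuous fun θ : ℝ => (θ ^ k) • S.op |(1 - θ) * τ| x :=
    (by fun_prop : Continuous fun θ : ℝ => θ ^ k).smul
      ((hS.2.continuous_orbit x).comp (by fun_prop : Continuous fun θ : ℝ => (1 - θ) * (τ : ℝ)))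
  have hc' : Continuous fun θ : ℝ => (θ ^ k) • regExpSymbol l ((1 - θ) * τ) :=
    (by fun_prop : Continuous fun θ : ℝ => θ ^ k).smul
      ((continuous_regExpSymbol l).comp (by fun_prop))
  have h1 : R (S.phi (k + 1) τ x) = R (Φ (phiSymbol k (τ • l)) x) := by
    rw [hphi, map_smul, ← R.intervalIntegral_comp_comm (hc.intervalIntegrable _ _), hR,
      ← calculus_mul_apply, ← integral_regExpSymbol, ← hE, map_smul,
      ← E.intervalIntegral_comp_comm (hc'.intervalIntegrable _ _)]
    congr 1
    refine intervalIntegral.integral_congr fun θ hθ => ?_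
    rw [uIcc_of_le zero_le_one] at hθ
    have h2 : 0 ≤ (1 - θ) * (τ : ℝ) := mul_nonneg (sub_nonneg.2 hθ.2) τ.2
    simp only [map_smul, abs_of_nonneg h2, op_eq_expSymbol hΦ hinj hA hS h2]
    congr 1
    rw [hE, hR, regExpSymbol, mul_comm (expSymbol l _),
      calculus_mul_apply Φ _ (expSymbol l _)]
  rw [← sub_eq_zero, ← map_sub] at h1
  refine sub_eq_zero.1 (hinj _ (fun q => ?_) _ h1)
  simp only [BoundedContinuousFunction.mul_apply, invSymbol_apply]
  positivity

end Identification

/-! ### Scalar estimates for the `φ`-functions -/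

section Scalar

theorem hasDerivAt_exp_neg_one_sub_mul (s θ : ℝ) : HasDerivAt
    (fun θ : ℝ => Real.exp (-((1 - θ) * s))) (s * Real.exp (-((1 - θ) * s))) θ := by
  have h1 : HasDerivAt (fun θ : ℝ => -((1 - θ) * s)) s θ :=
    (((hasDerivAt_id' θ).const_sub 1).mul_const s).neg.congr_deriv (by ring)
  exact h1.exp.congr_deriv (mul_comm _ _)

theorem mul_phiFun_zero (s : ℝ) : s * phiFun 0 s = 1 - Real.exp (-s) := by
  have hd : ∀ θ ∈ uIcc (0 : ℝ) 1, HasDerivAt (fun θ : ℝ => Real.exp (-((1 - θ) * s)))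
      (s * Real.exp (-((1 - θ) * s))) θ := fun θ _ =>
    hasDerivAt_exp_neg_one_sub_mul s θ
  have h := intervalIntegral.integral_eq_sub_of_hasDerivAt hd
    (Continuous.intervalIntegrable (by fun_prop) _ _)
  rw [intervalIntegral.integral_const_mul] at h
  simpa [phiFun] using h

theorem mul_phiFun_one (s : ℝ) : s * phiFun 1 s = 1 - phiFun 0 s := by
  have hd : ∀ θ ∈ uIcc (0 : ℝ) 1, HasDerivAt (fun θ : ℝ => θ * Real.exp (-((1 - θ) * s)))
      (Real.exp (-((1 - θ) * s)) + s * (θ * Real.exp (-((1 - θ) * s)))) θ := fun θ _ =>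
    ((hasDerivAt_id' θ).mul (hasDerivAt_exp_neg_one_sub_mul s θ)).congr_deriv (by ring)
  have h := intervalIntegral.integral_eq_sub_of_hasDerivAt hd
    (Continuous.intervalIntegrable (by fun_prop) _ _)
  rw [intervalIntegral.integral_add (Continuous.intervalIntegrable (by fun_prop) _ _)
    (Continuous.intervalIntegrable (by fun_prop) _ _), intervalIntegral.integral_const_mul] at h
  simp only [phiFun, Nat.factorial, pow_zero, one_mul, pow_one, Nat.cast_one, inv_one]
  simp only [sub_self, zero_mul, neg_zero, Real.exp_zero, one_mul, sub_zero] at h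
  linarith

variable {s : ℝ}

theorem phiFun_one_le (hs : 0 ≤ s) : phiFun 1 s ≤ 1 / 2 := by
  have h1 : ∫ θ in (0 : ℝ)..1, θ * Real.exp (-((1 - θ) * s)) ≤ ∫ θ in (0 : ℝ)..1, θ := by
    refine intervalIntegral.integral_mono_on zero_le_one
      (Continuous.intervalIntegrable (by fun_prop) _ _) (by simp) fun θ hθ => ?_
    exact mul_le_of_le_one_right hθ.1
      (Real.exp_le_one_iff.2 (by nlinarith [mul_nonneg (sub_nonneg.2 hθ.2) hs]))
  simpa [phiFun, integral_id] using h1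

theorem le_phiFun_one (s : ℝ) : 1 / 2 - s / 6 ≤ phiFun 1 s := by
  have h1 : ∫ θ in (0 : ℝ)..1, (θ - s * (θ - θ ^ 2)) ≤
      ∫ θ in (0 : ℝ)..1, θ * Real.exp (-((1 - θ) * s)) := by
    refine intervalIntegral.integral_mono_on zero_le_one
      (Continuous.intervalIntegrable (by fun_prop) _ _)
      (Continuous.intervalIntegrable (by fun_prop) _ _) fun θ hθ => ?_
    have := mul_le_mul_of_nonneg_left (Real.add_one_le_exp (-((1 - θ) * s))) hθ.1
    linarith
  rw [intervalIntegral.integral_sub (Continuous.intervalIntegrable (by fun_prop) _ _)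
    (Continuous.intervalIntegrable (by fun_prop) _ _), intervalIntegral.integral_const_mul,
    intervalIntegral.integral_sub (Continuous.intervalIntegrable (by fun_prop) _ _)
    (Continuous.intervalIntegrable (by fun_prop) _ _), integral_id, integral_pow] at h1
  simp only [phiFun, Nat.factorial, pow_one]
  norm_num at h1 ⊢
  linarith

theorem phiFun_zero_lower (hs : 0 ≤ s) : 1 ≤ (1 + s) * phiFun 0 s := by
  rcases hs.eq_or_lt with rfl | hs
  · simp [phiFun]
  · have h1 := mul_phiFun_zero s
    have h2 : (1 + s) * Real.exp (-s) ≤ 1 := by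
      rw [Real.exp_neg, ← div_eq_mul_inv, div_le_one (Real.exp_pos _)]
      linarith [Real.add_one_le_exp s]
    have h3 : s * 1 ≤ s * ((1 + s) * phiFun 0 s) := by
      have : s * ((1 + s) * phiFun 0 s) = (1 + s) - (1 + s) * Real.exp (-s) := by
        linear_combination (1 + s) * h1
      linarith
    exact le_of_mul_le_mul_left h3 hs

theorem phiFun_one_upper (hs : 0 ≤ s) : (1 + s) * phiFun 1 s ≤ 1 := by
  rcases hs.eq_or_lt with rfl | hs
  · simp [phiFun]
    norm_num
  · have h1 := mul_phiFun_one s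
    have h2 := phiFun_zero_lower hs.le
    have h3 : s * ((1 + s) * phiFun 1 s) ≤ s * 1 := by
      have : s * ((1 + s) * phiFun 1 s) = (1 + s) - (1 + s) * phiFun 0 s := by
        linear_combination (1 + s) * h1
      linarith
    exact le_of_mul_le_mul_left h3 hs

variable {a b : ℝ}

/-- The stability function of the scheme, `1 + φ₁(-a) φ₁(-b) (-a - b)`, lies in `[-1, 1]`. -/
theorem abs_stability_le (ha : 0 ≤ a) (hb : 0 ≤ b) :
    |1 - phiFun 0 a * phiFun 0 b * (a + b)| ≤ 1 := by
  have e : phiFun 0 a * phiFun 0 b * (a + b) =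
      phiFun 0 b * (1 - Real.exp (-a)) + phiFun 0 a * (1 - Real.exp (-b)) := by
    rw [← mul_phiFun_zero, ← mul_phiFun_zero]
    ring
  have h : ∀ x y : ℝ, 0 ≤ x → 0 ≤ y → 0 ≤ phiFun 0 x * (1 - Real.exp (-y)) ∧
      phiFun 0 x * (1 - Real.exp (-y)) ≤ 1 := fun x y hx hy => by
    have h1 : Real.exp (-y) ≤ 1 := Real.exp_le_one_iff.2 (by linarith)
    exact ⟨mul_nonneg (phiFun_nonneg _ _) (by linarith),
      mul_le_one₀ (phiFun_le_one 0 hx) (by linarith) (by linarith [Real.exp_pos (-y)])⟩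
  have h1 := h b a hb ha
  have h2 := h a b ha hb
  rw [e, abs_le]
  constructor <;> linarith [h1.1, h1.2, h2.1, h2.2]

/-- The recursion `1 - φ₁(-s) = s φ₂(-s)` in two variables. -/
theorem one_sub_phi_mul_phi (a b : ℝ) : 1 - phiFun 0 a * phiFun 0 b =
    a * phiFun 1 a + b * (phiFun 0 a * phiFun 1 b) := by
  linear_combination (-1 : ℝ) * mul_phiFun_one a - phiFun 0 a * mul_phiFun_one b

theorem one_sub_phi_mul_phi_nonneg (ha : 0 ≤ a) (hb : 0 ≤ b) :
    0 ≤ 1 - phiFun 0 a * phiFun 0 b := by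
  linarith [mul_le_one₀ (phiFun_le_one 0 ha) (phiFun_nonneg 0 b) (phiFun_le_one 0 hb)]

/-- Together with `half_sub_le`: `1 - φ₁(-a) φ₁(-b) = (a + b) / 2 + O((a + b)²)`. -/
theorem half_sub_nonneg (ha : 0 ≤ a) (hb : 0 ≤ b) :
    0 ≤ (a + b) / 2 - (1 - phiFun 0 a * phiFun 0 b) := by
  rw [one_sub_phi_mul_phi]
  have h1 := phiFun_one_le ha
  have h2 : phiFun 0 a * phiFun 1 b ≤ 1 / 2 :=
    (mul_le_of_le_one_left (phiFun_nonneg _ _) (phiFun_le_one 0 ha)).trans (phiFun_one_le hb)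
  have h3 := mul_le_mul_of_nonneg_left h1 ha
  have h4 := mul_le_mul_of_nonneg_left h2 hb
  linarith

theorem half_sub_le (ha : 0 ≤ a) (hb : 0 ≤ b) :
    (a + b) / 2 - (1 - phiFun 0 a * phiFun 0 b) ≤ (a + b) ^ 2 / 4 := by
  rw [one_sub_phi_mul_phi]
  have h1 := mul_le_mul_of_nonneg_left (le_phiFun_one a) ha
  -- `1 - φ₁ ≤ a / 2` and `φ₂ ≤ 1 / 2`
  have h5 : 1 - phiFun 0 a ≤ a / 2 := by
    rw [← mul_phiFun_one]
    have := mul_le_mul_of_nonneg_left (phiFun_one_le ha) ha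
    linarith
  have h6 : (1 - phiFun 0 a) * phiFun 1 b ≤ a / 2 * (1 / 2) :=
    mul_le_mul h5 (phiFun_one_le hb) (phiFun_nonneg _ _) (by linarith)
  have h2 : 1 / 2 - b / 6 - a / 4 ≤ phiFun 0 a * phiFun 1 b := by
    linarith [le_phiFun_one b]
  have h3 := mul_le_mul_of_nonneg_left h2 hb
  nlinarith [mul_nonneg ha hb]

/-- The quotient `(1 - φ₁(-a) φ₁(-b)) / (a + b)`, written so that its value at `a = b = 0` is the
limit `1 / 2` (using division by zero). -/
noncomputable def quotFun (a b : ℝ) : ℝ :=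
  1 / 2 - ((a + b) / 2 - (1 - phiFun 0 a * phiFun 0 b)) / (a + b)

theorem quotFun_mul (ha : 0 ≤ a) (hb : 0 ≤ b) :
    quotFun a b * (a + b) = 1 - phiFun 0 a * phiFun 0 b := by
  rcases (add_nonneg ha hb).eq_or_lt with h | h
  · have ha0 : a = 0 := by linarith
    have hb0 : b = 0 := by linarith
    subst ha0 hb0
    simp [phiFun]
  · rw [quotFun, sub_mul, div_mul_cancel₀ _ h.ne']
    ring

theorem half_sub_quotFun_nonneg (ha : 0 ≤ a) (hb : 0 ≤ b) : 0 ≤ 1 / 2 - quotFun a b := by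
  rw [quotFun, sub_sub_cancel]
  exact div_nonneg (half_sub_nonneg ha hb) (by linarith)

theorem half_sub_quotFun_le (ha : 0 ≤ a) (hb : 0 ≤ b) : 1 / 2 - quotFun a b ≤ (a + b) / 4 := by
  rw [quotFun, sub_sub_cancel]
  rcases (add_nonneg ha hb).eq_or_lt with h | h
  · simp [← h]
  · rw [div_le_iff₀ h]
    linarith [half_sub_le ha hb]

theorem quotFun_nonneg (ha : 0 ≤ a) (hb : 0 ≤ b) : 0 ≤ quotFun a b := by
  rcases (add_nonneg ha hb).eq_or_lt with h | h
  · have := half_sub_quotFun_le ha hb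
    linarith
  · have h1 := quotFun_mul ha hb
    have h2 := one_sub_phi_mul_phi_nonneg ha hb
    rw [← h1] at h2
    exact nonneg_of_mul_nonneg_left h2 h

/-- The leading coefficient of the local error is dominated by `1 - r`, where `r` is the stability
function. This is what allows summation by parts. -/
theorem abs_quotFun_sub_le (ha : 0 ≤ a) (hb : 0 ≤ b) :
    |quotFun a b - 2 * (phiFun 1 a * phiFun 1 b)| ≤ 3 * (phiFun 0 a * phiFun 0 b * (a + b)) := by
  have hab : 0 ≤ a + b := add_nonneg ha hb
  have hq0 := quotFun_nonneg ha hb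
  have hq1 := half_sub_quotFun_nonneg ha hb
  have hq2 := half_sub_quotFun_le ha hb
  have p0 : 0 ≤ phiFun 1 a * phiFun 1 b := mul_nonneg (phiFun_nonneg _ _) (phiFun_nonneg _ _)
  have hP : (1 + a) * (1 + b) ≥ 1 := by nlinarith
  have hP' : (1 + a) * (1 + b) ≤ (1 + (a + b) / 2) ^ 2 := by nlinarith [sq_nonneg (a - b)]
  have hlow : 1 ≤ (1 + a) * (1 + b) * (phiFun 0 a * phiFun 0 b) := by
    have := one_le_mul_of_one_le_of_one_le (phiFun_zero_lower ha) (phiFun_zero_lower hb)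
    linarith
  have hup : (1 + a) * (1 + b) * (phiFun 1 a * phiFun 1 b) ≤ 1 := by
    have := mul_le_one₀ (phiFun_one_upper ha)
      (mul_nonneg (by linarith) (phiFun_nonneg 1 b)) (phiFun_one_upper hb)
    linarith
  -- after multiplication by `(1 + a) (1 + b)` it remains to bound the left-hand side by `3 (a + b)`
  suffices h : (1 + a) * (1 + b) * |quotFun a b - 2 * (phiFun 1 a * phiFun 1 b)| ≤ 3 * (a + b) by
    have h1 : (1 + a) * (1 + b) * |quotFun a b - 2 * (phiFun 1 a * phiFun 1 b)| ≤
        (1 + a) * (1 + b) * (3 * (phiFun 0 a * phiFun 0 b * (a + b))) := by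
      have := mul_le_mul_of_nonneg_right hlow hab
      linarith
    exact le_of_mul_le_mul_left h1 (by linarith)
  rcases le_total (a + b) 1 with h1 | h1
  · have h2 : 1 / 2 - (a + b) / 6 ≤ 2 * (phiFun 1 a * phiFun 1 b) := by
      have h3 : 0 ≤ 1 / 2 - a / 6 := by linarith
      have h4 : 0 ≤ 1 / 2 - b / 6 := by linarith
      have := mul_le_mul (le_phiFun_one a) (le_phiFun_one b) h4 (phiFun_nonneg _ _)
      nlinarith [mul_nonneg ha hb]
    have h3 : 2 * (phiFun 1 a * phiFun 1 b) ≤ 1 / 2 := by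
      have := mul_le_mul (phiFun_one_le ha) (phiFun_one_le hb) (phiFun_nonneg _ _) (by norm_num)
      linarith
    have h4 : |quotFun a b - 2 * (phiFun 1 a * phiFun 1 b)| ≤ (a + b) / 2 := by
      rw [abs_le]
      constructor <;> linarith
    have h5 : (1 + a) * (1 + b) ≤ 9 / 4 := by nlinarith
    calc _ ≤ 9 / 4 * ((a + b) / 2) := mul_le_mul h5 h4 (abs_nonneg _) (by norm_num)
      _ ≤ _ := by linarith
  · have h2 : quotFun a b * (a + b) ≤ 1 := by
      rw [quotFun_mul ha hb]
      linarith [mul_nonneg (phiFun_nonneg 0 a) (phiFun_nonneg 0 b)]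
    have h3 : (1 + a) * (1 + b) * quotFun a b ≤ 3 * (a + b) := by
      have h4 : (1 + a) * (1 + b) ≤ 3 * (a + b) * (a + b) := by nlinarith
      calc _ ≤ 3 * (a + b) * (a + b) * quotFun a b := mul_le_mul_of_nonneg_right h4 hq0
        _ = 3 * (a + b) * (quotFun a b * (a + b)) := by ring
        _ ≤ 3 * (a + b) * 1 := mul_le_mul_of_nonneg_left h2 (by linarith)
        _ = _ := by ring
    have h5 : (1 + a) * (1 + b) * (2 * (phiFun 1 a * phiFun 1 b)) ≤ 3 * (a + b) := by linarith
    rw [← abs_of_pos (by linarith : 0 < (1 + a) * (1 + b)), ← abs_mul, mul_sub, abs_le]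
    have h6 : 0 ≤ (1 + a) * (1 + b) * quotFun a b := mul_nonneg (by linarith) hq0
    have h7 : 0 ≤ (1 + a) * (1 + b) * (2 * (phiFun 1 a * phiFun 1 b)) :=
      mul_nonneg (by linarith) (by linarith)
    constructor <;> linarith

end Scalar

section Symbols

variable {Q : Type*} [TopologicalSpace Q]

/-- The stability function of the scheme as a symbol. -/
noncomputable def stabSymbol (a b : C(Q, NNReal)) : Q →ᵇ ℝ :=
  BoundedContinuousFunction.ofNormedAddCommGroup
    (fun q => 1 - phiFun 0 (a q) * phiFun 0 (b q) * (a q + b q))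
    (by have := continuous_phiFun 0; fun_prop) 1
    fun q => abs_stability_le (a q).coe_nonneg (b q).coe_nonneg

theorem continuous_quotFun (a b : C(Q, NNReal)) :
    Continuous fun q => quotFun (a q) (b q) := by
  have hc := continuous_phiFun 0
  rw [continuous_iff_continuousAt]
  intro q
  by_cases h : (a q : ℝ) + b q = 0
  · have h0 : Tendsto (fun q => ((a q : ℝ) + b q) / 4) (𝓝 q) (𝓝 0) := by
      have : Continuous fun q => ((a q : ℝ) + b q) / 4 := by fun_prop
      simpa [h] using this.tendsto q
    have h1 : Tendsto (fun q => 1 / 2 - quotFun (a q) (b q)) (𝓝 q) (𝓝 0) :=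
      squeeze_zero (fun q => half_sub_quotFun_nonneg (a q).coe_nonneg (b q).coe_nonneg)
        (fun q => half_sub_quotFun_le (a q).coe_nonneg (b q).coe_nonneg) h0
    have h2 := h1.const_sub (1 / 2)
    simp only [sub_sub_cancel, sub_zero] at h2
    have h3 : quotFun (a q) (b q) = 1 / 2 := by simp [quotFun, h]
    rwa [ContinuousAt, h3]
  · refine continuousAt_const.sub (ContinuousAt.div (Continuous.continuousAt (by fun_prop))
      (Continuous.continuousAt (by fun_prop)) h)

/-- The symbol `(1 - φ₁(-a) φ₁(-b)) / (a + b)`. -/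
noncomputable def quotSymbol (a b : C(Q, NNReal)) : Q →ᵇ ℝ :=
  BoundedContinuousFunction.ofNormedAddCommGroup (fun q => quotFun (a q) (b q))
    (continuous_quotFun a b) (1 / 2) fun q => by
      rw [Real.norm_of_nonneg (quotFun_nonneg (a q).coe_nonneg (b q).coe_nonneg)]
      linarith [half_sub_quotFun_nonneg (a q).coe_nonneg (b q).coe_nonneg]

/-- The quotient of the leading coefficient of the local error by `1 - r + ε`, where `r` is the
stability function. The shift `ε > 0` makes the quotient continuous at the origin. -/
noncomputable def errSymbol (ε : ℝ) (hε : 0 < ε) (a b : C(Q, NNReal)) : Q →ᵇ ℝ :=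
  BoundedContinuousFunction.ofNormedAddCommGroup
    (fun q => (quotFun (a q) (b q) - 2 * (phiFun 1 (a q) * phiFun 1 (b q))) /
      (phiFun 0 (a q) * phiFun 0 (b q) * (a q + b q) + ε))
    (by
      have h0 := continuous_phiFun 0
      have h1 := continuous_phiFun 1
      refine Continuous.div ((continuous_quotFun a b).sub (by fun_prop)) (by fun_prop) fun q => ?_
      have := mul_nonneg (phiFun_nonneg 0 (a q)) (phiFun_nonneg 0 (b q))
      positivity) 3
    fun q => by
      have h1 := mul_nonneg (phiFun_nonneg 0 (a q)) (phiFun_nonneg 0 (b q))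
      have h2 : 0 < phiFun 0 (a q) * phiFun 0 (b q) * (a q + b q) + ε := by positivity
      rw [norm_div, Real.norm_eq_abs, Real.norm_of_nonneg h2.le, div_le_iff₀ h2]
      have := abs_quotFun_sub_le (a q).coe_nonneg (b q).coe_nonneg
      linarith

end Symbols

/-! ### One step of the scheme: stability and local error -/

section Scheme

variable {X : Type*} [NormedAddCommGroup X] [NormedSpace ℂ X] {Q : Type*} [TopologicalSpace Q]
  {Φ : (Q →ᵇ ℝ) →ₐ[ℝ] (X →L[ℂ] X)} {κ : ℝ}

theorem norm_calculus_apply_le (hΦ : ∀ F, ‖Φ F‖ ≤ κ * ‖F‖) (hκ : 0 ≤ κ) {F : Q →ᵇ ℝ} {c : ℝ}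
    (hc : 0 ≤ c) (hF : ∀ q, |F q| ≤ c) (x : X) : ‖Φ F x‖ ≤ κ * c * ‖x‖ :=
  ((Φ F).le_opNorm x).trans (mul_le_mul_of_nonneg_right ((hΦ F).trans
    (mul_le_mul_of_nonneg_left ((BoundedContinuousFunction.norm_le hc).2 hF) hκ)) (norm_nonneg x))

/-- `φ₁(-a) φ₁(-b)`. -/
noncomputable def phi11Symbol (a b : C(Q, NNReal)) : Q →ᵇ ℝ := phiSymbol 0 a * phiSymbol 0 b

/-- `φ₂(-a) φ₂(-b)`. -/
noncomputable def phi22Symbol (a b : C(Q, NNReal)) : Q →ᵇ ℝ := phiSymbol 1 a * phiSymbol 1 b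

theorem abs_phi_mul_phi_le (k : ℕ) (a b : C(Q, NNReal)) (q : Q) :
    |(phiSymbol k a * phiSymbol k b) q| ≤ 1 := by
  rw [BoundedContinuousFunction.mul_apply, phiSymbol_apply, phiSymbol_apply,
    abs_of_nonneg (mul_nonneg (phiFun_nonneg _ _) (phiFun_nonneg _ _))]
  exact mul_le_one₀ (phiFun_le_one _ (a q).coe_nonneg) (phiFun_nonneg _ _)
    (phiFun_le_one _ (b q).coe_nonneg)

theorem abs_phi11Symbol_le (a b : C(Q, NNReal)) (q : Q) : |phi11Symbol a b q| ≤ 1 :=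
  abs_phi_mul_phi_le 0 a b q

theorem abs_phi22Symbol_le (a b : C(Q, NNReal)) (q : Q) : |phi22Symbol a b q| ≤ 1 :=
  abs_phi_mul_phi_le 1 a b q

theorem abs_quotSymbol_le (a b : C(Q, NNReal)) (q : Q) : |quotSymbol a b q| ≤ 1 := by
  have h1 := quotFun_nonneg (a q).coe_nonneg (b q).coe_nonneg
  have h2 := half_sub_quotFun_nonneg (a q).coe_nonneg (b q).coe_nonneg
  change |quotFun (a q) (b q)| ≤ 1
  rw [abs_of_nonneg h1]
  linarith

theorem abs_errSymbol_le (ε : ℝ) (hε : 0 < ε) (a b : C(Q, NNReal)) (q : Q) :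
    |errSymbol ε hε a b q| ≤ 3 :=
  ((errSymbol ε hε a b).norm_coe_le_norm q).trans
    (BoundedContinuousFunction.norm_ofNormedAddCommGroup_le _ (by norm_num) _)

theorem abs_stabSymbol_pow_le (a b : C(Q, NNReal)) (j : ℕ) (q : Q) :
    |(stabSymbol a b ^ j) q| ≤ 1 := by
  rw [BoundedContinuousFunction.pow_apply, abs_pow]
  exact pow_le_one₀ (abs_nonneg _) (abs_stability_le (a q).coe_nonneg (b q).coe_nonneg)

/-- The leading coefficient of the local error is `(1 - r) Ψ` up to the small term `ε Ψ`. -/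
theorem errSymbol_identity (ε : ℝ) (hε : 0 < ε) (a b : C(Q, NNReal)) :
    quotSymbol a b - (2 : ℝ) • phi22Symbol a b =
      (1 - stabSymbol a b) * errSymbol ε hε a b + ε • errSymbol ε hε a b := by
  ext q
  have h1 := mul_nonneg (phiFun_nonneg 0 (a q)) (phiFun_nonneg 0 (b q))
  have h2 : phiFun 0 (a q) * phiFun 0 (b q) * (a q + b q) + ε ≠ 0 := by positivity
  change quotFun (a q) (b q) - 2 * (phiFun 1 (a q) * phiFun 1 (b q)) =
    (1 - (1 - phiFun 0 (a q) * phiFun 0 (b q) * (a q + b q))) *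
      ((quotFun (a q) (b q) - 2 * (phiFun 1 (a q) * phiFun 1 (b q))) /
      (phiFun 0 (a q) * phiFun 0 (b q) * (a q + b q) + ε)) +
      ε * ((quotFun (a q) (b q) - 2 * (phiFun 1 (a q) * phiFun 1 (b q))) /
      (phiFun 0 (a q) * phiFun 0 (b q) * (a q + b q) + ε))
  rw [sub_sub_cancel, ← add_mul, mul_div_cancel₀ _ h2]

variable {α β : C(Q, NNReal)} {τ : NNReal}

/-- `1 - φ₁(-τα) φ₁(-τβ) = τ (α + β) χ`, multiplied by the resolvent symbol. -/
theorem one_sub_phi11_mul_inv (τ : NNReal) (α β : C(Q, NNReal)) :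
    (1 - phi11Symbol (τ • α) (τ • β)) * invSymbol (α + β) =
      (τ : ℝ) • (quotSymbol (τ • α) (τ • β) * (1 - invSymbol (α + β))) := by
  ext q
  have h := quotFun_mul ((τ • α) q).coe_nonneg ((τ • β) q).coe_nonneg
  have h1 : 1 + ((α + β) q : ℝ) ≠ 0 := by positivity
  change (1 - phiFun 0 ((τ • α) q) * phiFun 0 ((τ • β) q)) * (1 + ((α + β) q : ℝ))⁻¹ =
    (τ : ℝ) * (quotFun ((τ • α) q) ((τ • β) q) * (1 - (1 + ((α + β) q : ℝ))⁻¹))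
  rw [← h]
  simp only [ContinuousMap.smul_apply, ContinuousMap.add_apply, NNReal.coe_add, smul_eq_mul,
    NNReal.coe_mul] at h1 ⊢
  field_simp
  ring

/-- `1 - r = τ (α + β) φ₁(-τα) φ₁(-τβ)`, multiplied by the resolvent symbol. -/
theorem one_sub_stab_mul_inv (τ : NNReal) (α β : C(Q, NNReal)) :
    (1 - stabSymbol (τ • α) (τ • β)) * invSymbol (α + β) =
      (τ : ℝ) • (phi11Symbol (τ • α) (τ • β) * (1 - invSymbol (α + β))) := by
  ext q
  have h1 : 1 + ((α + β) q : ℝ) ≠ 0 := by positivity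
  change (1 - (1 - phiFun 0 ((τ • α) q) * phiFun 0 ((τ • β) q) *
      (((τ • α) q : NNReal) + ((τ • β) q : NNReal)))) * (1 + ((α + β) q : ℝ))⁻¹ =
    (τ : ℝ) * (phiFun 0 ((τ • α) q) * phiFun 0 ((τ • β) q) * (1 - (1 + ((α + β) q : ℝ))⁻¹))
  simp only [ContinuousMap.smul_apply, ContinuousMap.add_apply, NNReal.coe_add, smul_eq_mul,
    NNReal.coe_mul] at h1 ⊢
  field_simp
  ring

theorem abs_half_sub_quot_mul_inv_le (τ : NNReal) (α β : C(Q, NNReal)) (q : Q) :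
    |(((1 / 2 : ℝ) • 1 - quotSymbol (τ • α) (τ • β)) * invSymbol (α + β)) q| ≤ τ := by
  have h1 := half_sub_quotFun_nonneg ((τ • α) q).coe_nonneg ((τ • β) q).coe_nonneg
  have h2 := half_sub_quotFun_le ((τ • α) q).coe_nonneg ((τ • β) q).coe_nonneg
  have h3 : 0 < 1 + ((α + β) q : ℝ) := by positivity
  change |(1 / 2 * 1 - quotFun ((τ • α) q) ((τ • β) q)) * (1 + ((α + β) q : ℝ))⁻¹| ≤ τ
  rw [mul_one, ← div_eq_mul_inv, abs_of_nonneg (div_nonneg h1 h3.le), div_le_iff₀ h3]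
  refine h2.trans ?_
  simp only [ContinuousMap.smul_apply, ContinuousMap.add_apply, NNReal.coe_add, smul_eq_mul,
    NNReal.coe_mul]
  nlinarith [τ.coe_nonneg, mul_nonneg τ.coe_nonneg (α q).coe_nonneg,
    mul_nonneg τ.coe_nonneg (β q).coe_nonneg]

/-- `φ₁(-τα) φ₁(-τβ)` has a bounded factor besides the resolvent symbol; hence the corresponding
operator maps into `D(A + B)`. -/
theorem phi11_factor (hτ : 0 < τ) : phi11Symbol (τ • α) (τ • β) = invSymbol (α + β) *
    (phi11Symbol (τ • α) (τ • β) + (τ : ℝ)⁻¹ • (1 - stabSymbol (τ • α) (τ • β))) := by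
  have h := one_sub_stab_mul_inv τ α β
  have hτ' : (τ : ℝ) ≠ 0 := by positivity
  rw [mul_add, mul_smul_comm, mul_comm (invSymbol _) (1 - _), h, smul_smul, inv_mul_cancel₀ hτ',
    one_smul]
  ring

/-- The analogue of `phi11_factor` for `φ₂(-τα) φ₂(-τβ)`. -/
theorem phi22_factor (hτ : 0 < τ) : phi22Symbol (τ • α) (τ • β) = invSymbol (α + β) *
    (phi22Symbol (τ • α) (τ • β) + (τ : ℝ)⁻¹ •
      ((1 - phiSymbol 0 (τ • α)) * phiSymbol 1 (τ • β) +
        phiSymbol 1 (τ • α) * (1 - phiSymbol 0 (τ • β)))) := by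
  ext q
  have h1 : 1 + ((α + β) q : ℝ) ≠ 0 := by positivity
  have hτ' : (τ : ℝ) ≠ 0 := by positivity
  change phiFun 1 ((τ • α) q) * phiFun 1 ((τ • β) q) = (1 + ((α + β) q : ℝ))⁻¹ *
    (phiFun 1 ((τ • α) q) * phiFun 1 ((τ • β) q) + (τ : ℝ)⁻¹ *
      ((1 - phiFun 0 ((τ • α) q)) * phiFun 1 ((τ • β) q) +
        phiFun 1 ((τ • α) q) * (1 - phiFun 0 ((τ • β) q))))
  rw [← mul_phiFun_one, ← mul_phiFun_one]
  simp only [ContinuousMap.smul_apply, ContinuousMap.add_apply, NNReal.coe_add, smul_eq_mul,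
    NNReal.coe_mul] at h1 ⊢
  field_simp

/-- If `F = c (α + β) G` and `y = -(α + β) x` then `F x = -c G y`. -/
theorem calculus_apply_of_factor {F G : Q →ᵇ ℝ} {c : ℝ}
    (h : F * invSymbol (α + β) = c • (G * (1 - invSymbol (α + β)))) {x y : X}
    (hx : Φ (invSymbol (α + β)) (x - y) = x) : Φ F x = -(c • Φ G y) := by
  conv_lhs => rw [← hx]
  rw [← calculus_mul_apply, h, calculus_smul_apply, calculus_mul_apply, calculus_sub_apply,
    calculus_one_apply, hx, sub_sub_cancel_left, map_neg, smul_neg]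

/-- One step of the scheme in the functional calculus, as a function of the current value `x` and
of `f = (A + B) x + g(x)`. -/
noncomputable def stepMap (Φ : (Q →ᵇ ℝ) →ₐ[ℝ] (X →L[ℂ] X)) (α β : C(Q, NNReal)) (g : X → X)
    (τ : NNReal) (x f : X) : X :=
  let U := x + (τ : ℝ) • Φ (phi11Symbol (τ • α) (τ • β)) f
  U + (2 * τ : ℝ) • Φ (phi22Symbol (τ • α) (τ • β)) (g U - g x)

/-- Stability: up to a term of size `O(τ)`, the difference of two numerical steps is the stability
operator applied to the difference of the arguments. -/
theorem norm_stepMap_sub_le (hΦ : ∀ F, ‖Φ F‖ ≤ κ * ‖F‖) (hκ : 0 ≤ κ) {g : X → X} {G : ℝ}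
    (hG : 0 ≤ G) (hg : ∀ x y, ‖g x - g y‖ ≤ G * ‖x - y‖) {v w u z : X}
    (hv : Φ (invSymbol (α + β)) (v - w) = v) (hu : Φ (invSymbol (α + β)) (u - z) = u) :
    ‖stepMap Φ α β g τ v (w + g v) - stepMap Φ α β g τ u (z + g u) -
        Φ (stabSymbol (τ • α) (τ • β)) (v - u)‖ ≤
      τ * (κ * G + 2 * κ * G * (κ * (1 + τ * G) + 1)) * ‖v - u‖ := by
  have hr : ∀ {x y : X}, Φ (invSymbol (α + β)) (x - y) = x →
      x + (τ : ℝ) • Φ (phi11Symbol (τ • α) (τ • β)) y = Φ (stabSymbol (τ • α) (τ • β)) x := by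
    intro x y hxy
    have h1 := calculus_apply_of_factor (one_sub_stab_mul_inv τ α β) hxy
    rw [calculus_sub_apply, calculus_one_apply] at h1
    rw [sub_eq_iff_eq_add'] at h1
    nth_rewrite 1 [h1]
    abel
  set P := Φ (phi11Symbol (τ • α) (τ • β)) with hP
  set W := Φ (phi22Symbol (τ • α) (τ • β)) with hW
  set R := Φ (stabSymbol (τ • α) (τ • β)) with hR
  have hU : ∀ {x y : X}, Φ (invSymbol (α + β)) (x - y) = x →
      x + (τ : ℝ) • P (y + g x) = R x + (τ : ℝ) • P (g x) := fun {x y} hxy => by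
    rw [← hr hxy, map_add, smul_add, add_assoc]
  have nP : ∀ x, ‖P x‖ ≤ κ * ‖x‖ := fun x => by
    simpa only [mul_one] using
      norm_calculus_apply_le hΦ hκ zero_le_one (abs_phi11Symbol_le (τ • α) (τ • β)) x
  have nW : ∀ x, ‖W x‖ ≤ κ * ‖x‖ := fun x => by
    simpa only [mul_one] using
      norm_calculus_apply_le hΦ hκ zero_le_one (abs_phi22Symbol_le (τ • α) (τ • β)) x
  have nR : ∀ x, ‖R x‖ ≤ κ * ‖x‖ := fun x => by
    simpa using norm_calculus_apply_le hΦ hκ zero_le_one (abs_stabSymbol_pow_le _ _ 1) x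
  simp only [stepMap]
  rw [hU hv, hU hu]
  set Uv := R v + (τ : ℝ) • P (g v) with hUv
  set Uu := R u + (τ : ℝ) • P (g u) with hUu
  have e1 : Uv - Uu = R (v - u) + (τ : ℝ) • P (g v - g u) := by
    rw [hUv, hUu, map_sub, map_sub, smul_sub]
    abel
  have hτ0 : (0 : ℝ) ≤ τ := τ.coe_nonneg
  have n1 : ‖(τ : ℝ) • P (g v - g u)‖ ≤ τ * (κ * (G * ‖v - u‖)) := by
    rw [norm_smul, Real.norm_of_nonneg hτ0]
    exact mul_le_mul_of_nonneg_left ((nP _).trans (mul_le_mul_of_nonneg_left (hg v u) hκ)) hτ0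
  have n2 : ‖Uv - Uu‖ ≤ κ * (1 + τ * G) * ‖v - u‖ := by
    rw [e1]
    refine (norm_add_le _ _).trans ((add_le_add (nR _) n1).trans (le_of_eq ?_))
    ring
  have n3 : ‖(2 * τ : ℝ) • W ((g Uv - g Uu) - (g v - g u))‖ ≤
      2 * τ * (κ * (G * (κ * (1 + τ * G) * ‖v - u‖) + G * ‖v - u‖)) := by
    rw [norm_smul, Real.norm_of_nonneg (by positivity)]
    refine mul_le_mul_of_nonneg_left ((nW _).trans (mul_le_mul_of_nonneg_left ?_ hκ))
      (by positivity)
    exact (norm_sub_le _ _).trans (add_le_add ((hg _ _).trans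
      (mul_le_mul_of_nonneg_left n2 hG)) (hg _ _))
  have e2 : Uv + (2 * τ : ℝ) • W (g Uv - g v) - (Uu + (2 * τ : ℝ) • W (g Uu - g u)) -
      R (v - u) = (τ : ℝ) • P (g v - g u) +
        (2 * τ : ℝ) • W ((g Uv - g Uu) - (g v - g u)) := by
    have e3 : W ((g Uv - g Uu) - (g v - g u)) = W (g Uv - g v) - W (g Uu - g u) := by
      rw [← map_sub]
      congr 1
      abel
    rw [e3, smul_sub, ← sub_eq_iff_eq_add'.2 e1]
    abel
  rw [e2]
  refine (norm_add_le _ _).trans ((add_le_add n1 n3).trans (le_of_eq ?_))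
  ring

/-- The constant in the bound for the local error. -/
noncomputable def localConst (κ G K : ℝ) : ℝ :=
  K + κ * (2 * K + (G * K ^ 2 + G * K)) + 2 * κ * (G * κ ^ 2 * K ^ 2 + G * κ * (K + G * K)) +
    3 * κ * (G * K)

/-- The local error is of third order up to the term `τ² (1 - R) Ψ w`, where `R` is the stability
operator. Here `u₁`, `u₂`, `u₃` are the derivatives of the solution at the current time, `w` and
`w'` those of `g(u)`. -/
theorem norm_local_error_le (hΦ : ∀ F, ‖Φ F‖ ≤ κ * ‖F‖) (hκ : 0 ≤ κ) (hτ : (0 : ℝ) < τ)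
    {g : X → X} {G K : ℝ} (hG : 0 ≤ G) {u u₁ u₂ u₃ w w' un : X} {D : X →L[ℝ] X}
    (hD : ‖D‖ ≤ G) (hgD : ∀ δ, ‖g (u + δ) - g u - D δ‖ ≤ G * ‖δ‖ ^ 2) (hw : w = D u₁)
    (h₁ : Φ (invSymbol (α + β)) (u₁ - (u₂ - w)) = u₁)
    (h₂ : Φ (invSymbol (α + β)) (u₂ - (u₃ - w')) = u₂)
    (n₁ : ‖u₁‖ ≤ K) (n₂ : ‖u₂‖ ≤ K) (n₃ : ‖u₃‖ ≤ K) (nw' : ‖w'‖ ≤ G * K ^ 2 + G * K)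
    (ht : ‖un - u - (τ : ℝ) • u₁ - ((τ : ℝ) ^ 2 / 2) • u₂‖ ≤ K * (τ : ℝ) ^ 3) :
    ‖un - stepMap Φ α β g τ u u₁ - (τ : ℝ) ^ 2 •
        (Φ (errSymbol τ hτ (τ • α) (τ • β)) w - Φ (stabSymbol (τ • α) (τ • β))
          (Φ (errSymbol τ hτ (τ • α) (τ • β)) w))‖ ≤ localConst κ G K * (τ : ℝ) ^ 3 := by
  have hτ0 : (0 : ℝ) ≤ τ := hτ.le
  have nw : ‖w‖ ≤ G * K := by
    rw [hw]
    exact (D.le_opNorm _).trans (mul_le_mul hD n₁ (norm_nonneg _) hG)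
  set P := Φ (phi11Symbol (τ • α) (τ • β)) with hP
  set W := Φ (phi22Symbol (τ • α) (τ • β)) with hW
  set R := Φ (stabSymbol (τ • α) (τ • β)) with hR
  set Z := Φ (quotSymbol (τ • α) (τ • β)) with hZ
  set Ψ := Φ (errSymbol τ hτ (τ • α) (τ • β)) with hΨ
  have nP : ∀ x, ‖P x‖ ≤ κ * ‖x‖ := fun x => by
    simpa only [mul_one] using
      norm_calculus_apply_le hΦ hκ zero_le_one (abs_phi11Symbol_le (τ • α) (τ • β)) x
  have nW : ∀ x, ‖W x‖ ≤ κ * ‖x‖ := fun x => by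
    simpa only [mul_one] using
      norm_calculus_apply_le hΦ hκ zero_le_one (abs_phi22Symbol_le (τ • α) (τ • β)) x
  have nZ : ∀ x, ‖Z x‖ ≤ κ * ‖x‖ := fun x => by
    simpa using norm_calculus_apply_le hΦ hκ zero_le_one (abs_quotSymbol_le _ _) x
  have nΨ : ∀ x, ‖Ψ x‖ ≤ κ * 3 * ‖x‖ := fun x =>
    norm_calculus_apply_le hΦ hκ (by norm_num) (abs_errSymbol_le _ hτ _ _) x
  -- `(1 - φ₁ φ₁) u'` is of first order, because `(A + B) u' = u'' - w`
  have e₁ : u₁ - P u₁ = -((τ : ℝ) • Z (u₂ - w)) := by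
    have := calculus_apply_of_factor (one_sub_phi11_mul_inv τ α β) h₁
    rwa [calculus_sub_apply, calculus_one_apply] at this
  have m₁ : ‖(τ : ℝ) • Z (u₂ - w)‖ ≤ τ * (κ * (K + G * K)) := by
    rw [norm_smul, Real.norm_of_nonneg hτ0]
    exact mul_le_mul_of_nonneg_left ((nZ _).trans (mul_le_mul_of_nonneg_left
      ((norm_sub_le _ _).trans (add_le_add n₂ nw)) hκ)) hτ0
  -- `(1/2 - Z) u''` is of first order, because `(A + B) u'' = u''' - w'`
  have m₂ : ‖(1 / 2 : ℝ) • u₂ - Z u₂‖ ≤ τ * (κ * (2 * K + (G * K ^ 2 + G * K))) := by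
    have e : (1 / 2 : ℝ) • u₂ - Z u₂ =
        Φ (((1 / 2 : ℝ) • 1 - quotSymbol (τ • α) (τ • β)) * invSymbol (α + β))
          (u₂ - (u₃ - w')) := by
      rw [calculus_mul_apply, h₂, calculus_sub_apply, calculus_smul_apply, calculus_one_apply]
    rw [e]
    refine (norm_calculus_apply_le hΦ hκ hτ0 (abs_half_sub_quot_mul_inv_le τ α β) _).trans ?_
    have n4 : ‖u₂ - (u₃ - w')‖ ≤ 2 * K + (G * K ^ 2 + G * K) := by
      have := (norm_sub_le u₂ (u₃ - w')).trans (add_le_add_right (norm_sub_le u₃ w') _)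
      linarith
    calc κ * τ * ‖u₂ - (u₃ - w')‖ ≤ κ * τ * (2 * K + (G * K ^ 2 + G * K)) :=
          mul_le_mul_of_nonneg_left n4 (by positivity)
      _ = _ := by ring
  set U := u + (τ : ℝ) • P u₁ with hU
  -- linearization of `g` at the current value
  have m₃ : ‖g U - g u - (τ : ℝ) • w‖ ≤
      (τ : ℝ) ^ 2 * (G * κ ^ 2 * K ^ 2 + G * κ * (K + G * K)) := by
    have e : g U - g u - (τ : ℝ) • w = (g U - g u - D ((τ : ℝ) • P u₁)) +
        (τ : ℝ) • D ((τ : ℝ) • Z (u₂ - w)) := by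
      have e3 : (τ : ℝ) • Z (u₂ - w) = P u₁ - u₁ := by rw [← neg_sub u₁, e₁, neg_neg]
      rw [e3, map_sub, hw, smul_sub, map_smul]
      abel
    have nδ : ‖(τ : ℝ) • P u₁‖ ≤ τ * (κ * K) := by
      rw [norm_smul, Real.norm_of_nonneg hτ0]
      exact mul_le_mul_of_nonneg_left ((nP _).trans (mul_le_mul_of_nonneg_left n₁ hκ)) hτ0
    have n5 : ‖g U - g u - D ((τ : ℝ) • P u₁)‖ ≤ G * (τ * (κ * K)) ^ 2 :=
      (hgD _).trans (mul_le_mul_of_nonneg_left (pow_le_pow_left₀ (norm_nonneg _) nδ 2) hG)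
    have n6 : ‖(τ : ℝ) • D ((τ : ℝ) • Z (u₂ - w))‖ ≤ τ * (G * (τ * (κ * (K + G * K)))) := by
      rw [norm_smul, Real.norm_of_nonneg hτ0]
      exact mul_le_mul_of_nonneg_left ((D.le_opNorm _).trans
        (mul_le_mul hD m₁ (norm_nonneg _) hG)) hτ0
    rw [e]
    refine (norm_add_le _ _).trans ((add_le_add n5 n6).trans (le_of_eq ?_))
    ring
  have e₂ : Z w - (2 : ℝ) • W w = Ψ w - R (Ψ w) + (τ : ℝ) • Ψ w := by
    have := congrArg (fun F => Φ F w) (errSymbol_identity (τ : ℝ) hτ (τ • α) (τ • β))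
    simp only [calculus_sub_apply, calculus_add_apply, calculus_smul_apply, calculus_mul_apply,
      calculus_one_apply] at this
    exact this
  have e₃ : un - stepMap Φ α β g τ u u₁ - (τ : ℝ) ^ 2 • (Ψ w - R (Ψ w)) =
      (un - u - (τ : ℝ) • u₁ - ((τ : ℝ) ^ 2 / 2) • u₂) +
      (τ : ℝ) ^ 2 • ((1 / 2 : ℝ) • u₂ - Z u₂) -
      (2 * τ : ℝ) • W (g U - g u - (τ : ℝ) • w) + (τ : ℝ) ^ 3 • Ψ w := by
    have e4 : Ψ w - R (Ψ w) = Z w - (2 : ℝ) • W w - (τ : ℝ) • Ψ w := by rw [e₂]; abel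
    have e5 : P u₁ = u₁ + (τ : ℝ) • (Z u₂ - Z w) := by
      rw [← map_sub, ← sub_eq_iff_eq_add', ← neg_sub, e₁, neg_neg]
    have e6 : W (g U - g u - (τ : ℝ) • w) = W (g U - g u) - (τ : ℝ) • W w := by
      rw [map_sub, ContinuousLinearMap.map_smul_of_tower]
    have e7 : stepMap Φ α β g τ u u₁ = U + (2 * τ : ℝ) • W (g U - g u) := rfl
    rw [e4, e6, e7]
    generalize W (g U - g u) = y
    rw [hU, e5]
    module
  rw [e₃]
  have n7 : ‖(τ : ℝ) ^ 2 • ((1 / 2 : ℝ) • u₂ - Z u₂)‖ ≤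
      (τ : ℝ) ^ 2 * (τ * (κ * (2 * K + (G * K ^ 2 + G * K)))) := by
    rw [norm_smul, Real.norm_of_nonneg (by positivity)]
    exact mul_le_mul_of_nonneg_left m₂ (by positivity)
  have n8 : ‖(2 * τ : ℝ) • W (g U - g u - (τ : ℝ) • w)‖ ≤ 2 * τ * (κ *
      ((τ : ℝ) ^ 2 * (G * κ ^ 2 * K ^ 2 + G * κ * (K + G * K)))) := by
    rw [norm_smul, Real.norm_of_nonneg (by positivity)]
    exact mul_le_mul_of_nonneg_left ((nW _).trans (mul_le_mul_of_nonneg_left m₃ hκ))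
      (by positivity)
  have n9 : ‖(τ : ℝ) ^ 3 • Ψ w‖ ≤ (τ : ℝ) ^ 3 * (κ * 3 * (G * K)) := by
    rw [norm_smul, Real.norm_of_nonneg (by positivity)]
    exact mul_le_mul_of_nonneg_left ((nΨ _).trans (mul_le_mul_of_nonneg_left nw (by positivity)))
      (by positivity)
  refine (norm_add_le _ _).trans ((add_le_add ((norm_sub_le _ _).trans
    (add_le_add ((norm_add_le _ _).trans (add_le_add ht n7)) n8)) n9).trans (le_of_eq ?_))
  rw [localConst]
  ring

/-- A discrete Gronwall lemma for recursions with a power-bounded operator. -/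
theorem norm_le_of_power_bounded {R : X →L[ℂ] X} (hκ : 0 ≤ κ)
    (hR : ∀ (j : ℕ) (x : X), ‖(R ^ j) x‖ ≤ κ * ‖x‖) {E : ℕ → X} {x y : ℝ} (hx : 0 ≤ x) (hy : 0 ≤ y)
    {N : ℕ} (h : ∀ n < N, ‖E (n + 1) - R (E n)‖ ≤ x * ‖E n‖ + y) :
    ∀ n ≤ N, ‖E n‖ ≤ (1 + κ * x) ^ n * (κ * ‖E 0‖ + n * (κ * y)) := by
  suffices H : ∀ n ≤ N, ∀ j : ℕ,
      ‖(R ^ j) (E n)‖ ≤ (1 + κ * x) ^ n * (κ * ‖E 0‖ + n * (κ * y)) from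
    fun n hn => by simpa using H n hn 0
  intro n
  induction n with
  | zero => exact fun _ j => by simpa using hR j (E 0)
  | succ n ih =>
    intro hn j
    set a := (1 + κ * x) ^ n * (κ * ‖E 0‖ + n * (κ * y)) with ha
    have h1 := ih (by omega) (j + 1)
    have h2 : ‖E n‖ ≤ a := by simpa using ih (by omega) 0
    have e : (R ^ j) (E (n + 1)) = (R ^ (j + 1)) (E n) + (R ^ j) (E (n + 1) - R (E n)) := by
      rw [map_sub, pow_succ]
      change _ = (R ^ j) (R (E n)) + _
      abel
    have h3 : ‖(R ^ j) (E (n + 1) - R (E n))‖ ≤ κ * (x * a + y) :=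
      (hR j _).trans (mul_le_mul_of_nonneg_left ((h n (by omega)).trans (by gcongr)) hκ)
    have h4 : 1 ≤ (1 + κ * x) ^ (n + 1) := one_le_pow₀ (by nlinarith [mul_nonneg hκ hx])
    have h5 : 0 ≤ κ * y := mul_nonneg hκ hy
    rw [e]
    calc _ ≤ a + κ * (x * a + y) := (norm_add_le _ _).trans (add_le_add h1 h3)
      _ = (1 + κ * x) * a + 1 * (κ * y) := by ring
      _ ≤ (1 + κ * x) * a + (1 + κ * x) ^ (n + 1) * (κ * y) := by gcongr
      _ = _ := by
        rw [ha]
        push_cast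
        ring

end Scheme

/-! ### Regularity of the solution and convergence -/

section Calculus

variable {E : Type*} [NormedAddCommGroup E] [NormedSpace ℝ E]

/-- Second-order Taylor expansion with remainder bounded through the third derivative. -/
theorem norm_taylor_two_le {T K : ℝ} {f f₁ f₂ f₃ : ℝ → E}
    (h₀ : ∀ t ∈ Icc 0 T, HasDerivWithinAt f (f₁ t) (Icc 0 T) t)
    (h₁ : ∀ t ∈ Icc 0 T, HasDerivWithinAt f₁ (f₂ t) (Icc 0 T) t)
    (h₂ : ∀ t ∈ Icc 0 T, HasDerivWithinAt f₂ (f₃ t) (Icc 0 T) t)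
    (hK : ∀ t ∈ Icc 0 T, ‖f₃ t‖ ≤ K) {t τ : ℝ} (ht : 0 ≤ t) (hτ : 0 ≤ τ) (htT : t + τ ≤ T) :
    ‖f (t + τ) - f t - τ • f₁ t - (τ ^ 2 / 2) • f₂ t‖ ≤ K * τ ^ 3 := by
  have hK0 : 0 ≤ K := (norm_nonneg _).trans (hK t ⟨ht, by linarith⟩)
  have hsub : Icc t (t + τ) ⊆ Icc 0 T := Icc_subset_Icc ht htT
  have hcv : Convex ℝ (Icc t (t + τ)) := convex_Icc _ _
  have hmem : t ∈ Icc t (t + τ) := ⟨le_rfl, by linarith⟩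
  have hlen : ∀ s ∈ Icc t (t + τ), ‖s - t‖ ≤ τ := fun s hs => by
    rw [Real.norm_eq_abs, abs_of_nonneg (by linarith [hs.1])]
    linarith [hs.2]
  have b₂ : ∀ s ∈ Icc t (t + τ), ‖f₂ s - f₂ t‖ ≤ K * τ := fun s hs =>
    (hcv.norm_image_sub_le_of_norm_hasDerivWithin_le
      (fun r hr => (h₂ r (hsub hr)).mono hsub) (fun r hr => hK r (hsub hr)) hmem hs).trans
      (mul_le_mul_of_nonneg_left (hlen s hs) hK0)
  have b₁ : ∀ s ∈ Icc t (t + τ), ‖f₁ s - f₁ t - (s - t) • f₂ t‖ ≤ K * τ * τ := fun s hs => by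
    have hd : ∀ r ∈ Icc t (t + τ), HasDerivWithinAt (fun r => f₁ r - (r - t) • f₂ t)
        (f₂ r - f₂ t) (Icc t (t + τ)) r := fun r hr => by
      have h := ((h₁ r (hsub hr)).mono hsub).sub
        (((hasDerivWithinAt_id r (Icc t (t + τ))).sub_const t).smul_const (f₂ t))
      rw [one_smul] at h
      exact h
    have h := hcv.norm_image_sub_le_of_norm_hasDerivWithin_le hd b₂ hmem hs
    rw [sub_self, zero_smul, sub_zero] at h
    rw [sub_right_comm]
    exact h.trans (mul_le_mul_of_nonneg_left (hlen s hs) (by positivity))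
  have hd : ∀ r ∈ Icc t (t + τ), HasDerivWithinAt
      (fun r => f r - (r - t) • f₁ t - ((r - t) ^ 2 / 2) • f₂ t)
      (f₁ r - f₁ t - (r - t) • f₂ t) (Icc t (t + τ)) r := fun r hr => by
    have h1 := (hasDerivWithinAt_id r (Icc t (t + τ))).sub_const t
    have h := (((h₀ r (hsub hr)).mono hsub).sub (h1.smul_const (f₁ t))).sub
      (((h1.pow 2).div_const 2).smul_const (f₂ t))
    refine h.congr_deriv ?_
    simp
  have h := hcv.norm_image_sub_le_of_norm_hasDerivWithin_le hd b₁ hmem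
    (show t + τ ∈ Icc t (t + τ) from ⟨by linarith, le_rfl⟩)
  rw [sub_self, zero_smul, add_sub_cancel_left, Real.norm_of_nonneg hτ] at h
  refine le_trans (le_of_eq ?_) (h.trans (le_of_eq (by ring)))
  congr 1
  simp
  abel

variable {g : E → E} {G : ℝ}

theorem norm_sub_le_of_fderiv_bound (hg : Differentiable ℝ g) (hG : ∀ x, ‖fderiv ℝ g x‖ ≤ G)
    (x y : E) : ‖g x - g y‖ ≤ G * ‖x - y‖ :=
  convex_univ.norm_image_sub_le_of_norm_fderiv_le (fun z _ => hg z) (fun z _ => hG z)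
    (mem_univ y) (mem_univ x)

theorem norm_linearization_le (hg : Differentiable ℝ g) (hg' : Differentiable ℝ (fderiv ℝ g))
    (hG : ∀ x, ‖fderiv ℝ (fderiv ℝ g) x‖ ≤ G) (u δ : E) :
    ‖g (u + δ) - g u - fderiv ℝ g u δ‖ ≤ G * ‖δ‖ ^ 2 := by
  have hG0 : 0 ≤ G := (norm_nonneg _).trans (hG u)
  have h1 : ∀ x ∈ Metric.closedBall u ‖δ‖, ‖fderiv ℝ g x - fderiv ℝ g u‖ ≤ G * ‖δ‖ := fun x hx =>
    (convex_univ.norm_image_sub_le_of_norm_fderiv_le (fun z _ => hg' z) (fun z _ => hG z)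
      (mem_univ u) (mem_univ x)).trans
      (mul_le_mul_of_nonneg_left (by simpa [dist_eq_norm] using hx) hG0)
  have h := (convex_closedBall u ‖δ‖).norm_image_sub_le_of_norm_fderiv_le' (fun z _ => hg z) h1
    (Metric.mem_closedBall_self (norm_nonneg _))
    (show u + δ ∈ Metric.closedBall u ‖δ‖ by simp [dist_eq_norm])
  rw [add_sub_cancel_left] at h
  refine h.trans (le_of_eq ?_)
  ring

/-- A bounded linear identity along curves may be differentiated. -/
theorem hasDeriv_eq_of_eqOn {T : ℝ} (hT : 0 < T) {R : E →L[ℝ] E} {f f' k k' : ℝ → E}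
    (hf : ∀ t ∈ Icc 0 T, HasDerivWithinAt f (f' t) (Icc 0 T) t)
    (hk : ∀ t ∈ Icc 0 T, HasDerivWithinAt k (k' t) (Icc 0 T) t)
    (h : ∀ t ∈ Icc 0 T, R (k t) = f t) : ∀ t ∈ Icc 0 T, R (k' t) = f' t := fun t ht =>
  ((uniqueDiffOn_Icc hT) t ht).eq_deriv _
    ((R.hasFDerivAt.comp_hasDerivWithinAt t (hk t ht)).congr_of_mem
      (fun s hs => (h s hs).symm) ht) (hf t ht)

end Calculus

section Solution

variable {X : Type*} [NormedAddCommGroup X] [NormedSpace ℂ X] {Q : Type*} [TopologicalSpace Q]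
  {Φ : (Q →ᵇ ℝ) →ₐ[ℝ] (X →L[ℂ] X)} {L : X →ₗ.[ℂ] X} {l : C(Q, NNReal)}

/-- The differential equation and its first two derivatives, with the operator in resolvent form.
In this form the equation extends to `t = 0` by continuity, and it may be differentiated although
the operator is unbounded. -/
theorem solution_regularity (hL : HasSymbol Φ L l) {T G K : ℝ} (hT : 0 < T) {g : X → X}
    (hg : Differentiable ℝ g) (hg' : Differentiable ℝ (fderiv ℝ g))
    (hG : ∀ x, ‖fderiv ℝ g x‖ ≤ G) (hG' : ∀ x, ‖fderiv ℝ (fderiv ℝ g) x‖ ≤ G) {u : ℝ → X}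
    (hu : ContDiffOn ℝ 3 u (Icc 0 T))
    (hK : ∀ j ∈ Finset.Icc 1 3, ∀ t ∈ Icc 0 T, ‖iteratedDerivWithin j u (Icc 0 T) t‖ ≤ K)
    (hsol : IsSolution L g T u) :
    ∃ u₁ u₂ u₃ w w' : ℝ → X,
      (∀ t ∈ Icc 0 T, HasDerivWithinAt u (u₁ t) (Icc 0 T) t) ∧
      (∀ t ∈ Icc 0 T, HasDerivWithinAt u₁ (u₂ t) (Icc 0 T) t) ∧
      (∀ t ∈ Icc 0 T, HasDerivWithinAt u₂ (u₃ t) (Icc 0 T) t) ∧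
      (∀ t ∈ Icc 0 T, HasDerivWithinAt w (w' t) (Icc 0 T) t) ∧
      (∀ t, w t = fderiv ℝ g (u t) (u₁ t)) ∧
      (∀ t ∈ Icc 0 T, ‖u₁ t‖ ≤ K ∧ ‖u₂ t‖ ≤ K ∧ ‖u₃ t‖ ≤ K ∧ ‖w' t‖ ≤ G * K ^ 2 + G * K) ∧
      (∀ t ∈ Icc 0 T, Φ (invSymbol l) (u t - (u₁ t - g (u t))) = u t) ∧
      (∀ t ∈ Icc 0 T, Φ (invSymbol l) (u₁ t - (u₂ t - w t)) = u₁ t) ∧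
      (∀ t ∈ Icc 0 T, Φ (invSymbol l) (u₂ t - (u₃ t - w' t)) = u₂ t) := by
  have hG0 : 0 ≤ G := (norm_nonneg _).trans (hG 0)
  have hUD := uniqueDiffOn_Icc hT
  have hder : ∀ j : ℕ, j < 3 → ∀ t ∈ Icc 0 T, HasDerivWithinAt
      (iteratedDerivWithin j u (Icc 0 T)) (iteratedDerivWithin (j + 1) u (Icc 0 T) t)
      (Icc 0 T) t := fun j hj t ht => by
    have h1 := (hu.differentiableOn_iteratedDerivWithin (m := j) (by exact_mod_cast hj) hUD) t ht
    rw [iteratedDerivWithin_succ]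
    exact h1.hasDerivWithinAt
  set u₁ := iteratedDerivWithin 1 u (Icc 0 T) with hu₁
  set u₂ := iteratedDerivWithin 2 u (Icc 0 T) with hu₂
  set u₃ := iteratedDerivWithin 3 u (Icc 0 T) with hu₃
  have d₀ : ∀ t ∈ Icc 0 T, HasDerivWithinAt u (u₁ t) (Icc 0 T) t := fun t ht => by
    have := hder 0 (by norm_num) t ht
    rwa [iteratedDerivWithin_zero] at this
  have d₁ : ∀ t ∈ Icc 0 T, HasDerivWithinAt u₁ (u₂ t) (Icc 0 T) t := hder 1 (by norm_num)
  have d₂ : ∀ t ∈ Icc 0 T, HasDerivWithinAt u₂ (u₃ t) (Icc 0 T) t := hder 2 (by norm_num)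
  have n₁ : ∀ t ∈ Icc 0 T, ‖u₁ t‖ ≤ K := hK 1 (by simp)
  have n₂ : ∀ t ∈ Icc 0 T, ‖u₂ t‖ ≤ K := hK 2 (by simp)
  have n₃ : ∀ t ∈ Icc 0 T, ‖u₃ t‖ ≤ K := hK 3 (by simp)
  have dg : ∀ t ∈ Icc 0 T, HasDerivWithinAt (fun t => g (u t)) (fderiv ℝ g (u t) (u₁ t))
      (Icc 0 T) t := fun t ht =>
    (hg (u t)).hasFDerivAt.comp_hasDerivWithinAt t (d₀ t ht)
  have dw : ∀ t ∈ Icc 0 T, HasDerivWithinAt (fun t => fderiv ℝ g (u t) (u₁ t))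
      (fderiv ℝ (fderiv ℝ g) (u t) (u₁ t) (u₁ t) + fderiv ℝ g (u t) (u₂ t)) (Icc 0 T) t :=
    fun t ht => ((hg' (u t)).hasFDerivAt.comp_hasDerivWithinAt t (d₀ t ht)).clm_apply (d₁ t ht)
  let R : X →L[ℝ] X := (Φ (invSymbol l)).restrictScalars ℝ
  have e₀' : ∀ t ∈ Ioc 0 T, R (u t - (u₁ t - g (u t))) = u t := fun t ht => by
    obtain ⟨h, hd⟩ := hsol t ht
    have ht' : t ∈ Icc 0 T := Ioc_subset_Icc_self ht
    have h1 : u₁ t = L ⟨u t, h⟩ + g (u t) := (hUD t ht').eq_deriv _ (d₀ t ht') hd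
    rw [h1, add_sub_cancel_right]
    exact (hL _ _).1 (LinearPMap.mem_graph L ⟨u t, h⟩)
  have e₀ : ∀ t ∈ Icc 0 T, R (u t - (u₁ t - g (u t))) = u t := fun t ht => by
    have hc : ContinuousOn (fun t => R (u t - (u₁ t - g (u t))) - u t) (Icc 0 T) := fun s hs =>
      ((R.continuous.continuousAt.comp_continuousWithinAt
        ((d₀ s hs).continuousWithinAt.sub ((d₁ s hs).continuousWithinAt.sub
          (dg s hs).continuousWithinAt))).sub (d₀ s hs).continuousWithinAt)
    have h1 : EqOn (fun t => R (u t - (u₁ t - g (u t))) - u t) (fun _ => 0) (Icc 0 T) := by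
      refine EqOn.of_subset_closure (s := Ioc 0 T) (fun s hs => ?_) hc continuousOn_const
        Ioc_subset_Icc_self ?_
      · simp only [e₀' s hs, sub_self]
      · rw [closure_Ioc hT.ne]
    exact sub_eq_zero.1 (h1 ht)
  have e₁ : ∀ t ∈ Icc 0 T, R (u₁ t - (u₂ t - fderiv ℝ g (u t) (u₁ t))) = u₁ t :=
    hasDeriv_eq_of_eqOn hT d₀ (fun t ht => (d₀ t ht).sub ((d₁ t ht).sub (dg t ht))) e₀
  have e₂ := hasDeriv_eq_of_eqOn hT d₁ (fun t ht => (d₁ t ht).sub ((d₂ t ht).sub (dw t ht))) e₁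
  refine ⟨u₁, u₂, u₃, _, _, d₀, d₁, d₂, dw, fun t => rfl,
    fun t ht => ⟨n₁ t ht, n₂ t ht, n₃ t ht, ?_⟩, e₀, e₁, e₂⟩
  refine (norm_add_le _ _).trans (add_le_add ?_ ?_)
  · refine ((fderiv ℝ (fderiv ℝ g) (u t)).le_opNorm₂ _ _).trans ?_
    rw [sq, ← mul_assoc]
    have := n₁ t ht
    have hK0 : 0 ≤ K := (norm_nonneg _).trans this
    gcongr
    exact hG' _
  · exact ((fderiv ℝ g (u t)).le_opNorm _).trans
      (mul_le_mul (hG _) (n₂ t ht) (norm_nonneg _) hG0)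

end Solution

section Scheme

variable {X : Type*} [NormedAddCommGroup X] [NormedSpace ℂ X] {Q : Type*} [TopologicalSpace Q]
  {Φ : (Q →ᵇ ℝ) →ₐ[ℝ] (X →L[ℂ] X)} {κ : ℝ} {α β : C(Q, NNReal)} {A B : X →ₗ.[ℂ] X}
  {SA SB : C0Semigroup X} {g : X → X} {τ : NNReal}

theorem mem_domain_of_eq_inv (hAB : HasSymbol Φ (A + B) (α + β)) {x z : X}
    (h : x = Φ (invSymbol (α + β)) z) : x ∈ (A + B).domain := by
  have h1 : (x, x - z) ∈ (A + B).graph := (hAB _ _).2 (by rw [sub_sub_cancel, ← h])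
  exact LinearPMap.mem_domain_of_mem_graph h1

/-- Every step of the scheme stays in `D(A + B)`, because the `φ`-products map into it. -/
theorem stepMap_mem_domain (hAB : HasSymbol Φ (A + B) (α + β)) (hτ : 0 < τ) {x : X}
    (hx : x ∈ (A + B).domain) (f : X) : stepMap Φ α β g τ x f ∈ (A + B).domain := by
  have h1 : ∀ f, Φ (phi11Symbol (τ • α) (τ • β)) f ∈ (A + B).domain := fun f =>
    mem_domain_of_eq_inv hAB (by rw [← calculus_mul_apply, ← phi11_factor hτ])
  have h2 : ∀ f, Φ (phi22Symbol (τ • α) (τ • β)) f ∈ (A + B).domain := fun f =>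
    mem_domain_of_eq_inv hAB (by rw [← calculus_mul_apply, ← phi22_factor hτ])
  have hs : ∀ (c : ℝ) (y : X), y ∈ (A + B).domain → c • y ∈ (A + B).domain := fun c y hy =>
    (A + B).domain.smul_mem (c : ℂ) hy
  exact (A + B).domain.add_mem ((A + B).domain.add_mem hx (hs _ _ (h1 _))) (hs _ _ (h2 _))

theorem isERK2Step_iff [CompleteSpace X] (hΦ : ∀ F, ‖Φ F‖ ≤ κ * ‖F‖)
    (hinj : ∀ F, (∀ q, F q ≠ 0) → ∀ x, Φ F x = 0 → x = 0) (hA : HasSymbol Φ A α)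
    (hB : HasSymbol Φ B β) (hSA : SA.IsAnalyticGeneratedBy A) (hSB : SB.IsAnalyticGeneratedBy B)
    (x y : X) : IsERK2Step A B SA SB g τ x y ↔
      ∃ hx : x ∈ (A + B).domain, y = stepMap Φ α β g τ x ((A + B) ⟨x, hx⟩ + g x) := by
  have h : ∀ (k : ℕ) z, SA.phi (k + 1) τ (SB.phi (k + 1) τ z) =
      Φ (phiSymbol k (τ • α) * phiSymbol k (τ • β)) z := fun k z => by
    rw [phi_eq_phiSymbol hΦ hinj hB hSB, phi_eq_phiSymbol hΦ hinj hA hSA, calculus_mul_apply]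
  simp only [IsERK2Step, h 0, h 1]
  rfl

/-- The constant in the convergence estimate. -/
noncomputable def convConst (T κ G K : ℝ) : ℝ :=
  let M := 3 * κ * (G * K)
  let S := κ * G + 2 * κ * G * (κ * (1 + T * G) + 1)
  Real.exp (κ * S * T) *
    (κ * M + T * (κ * (S * M + localConst κ G K + 3 * κ * (G * K ^ 2 + G * K)))) + M

/-- The corrected error `E = e + τ² Ψ w` satisfies a recursion with the power-bounded operator `R`
and perturbations `O(τ) ‖E‖ + O(τ³)`. -/
theorem convergence (hΦ : ∀ F, ‖Φ F‖ ≤ κ * ‖F‖) (hκ : 0 ≤ κ) (hτ : (0 : ℝ) < τ)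
    (hAB : HasSymbol Φ (A + B) (α + β)) {T G K : ℝ} (hT : 0 < T)
    (hg : Differentiable ℝ g) (hg' : Differentiable ℝ (fderiv ℝ g))
    (hG : ∀ x, ‖fderiv ℝ g x‖ ≤ G) (hG' : ∀ x, ‖fderiv ℝ (fderiv ℝ g) x‖ ≤ G) {u : ℝ → X}
    (hu : ContDiffOn ℝ 3 u (Icc 0 T))
    (hK : ∀ j ∈ Finset.Icc 1 3, ∀ t ∈ Icc 0 T, ‖iteratedDerivWithin j u (Icc 0 T) t‖ ≤ K)
    (hsol : IsSolution (A + B) g T u) {v : ℕ → X} (hv0 : v 0 = u 0) {n : ℕ}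
    (hv : ∀ k < n, ∃ hx : v k ∈ (A + B).domain,
      v (k + 1) = stepMap Φ α β g τ (v k) ((A + B) ⟨v k, hx⟩ + g (v k)))
    (hn : (n : ℝ) * τ ≤ T) : ‖v n - u (n * τ)‖ ≤ convConst T κ G K * (τ : ℝ) ^ 2 := by
  obtain ⟨u₁, u₂, u₃, w, w', d₀, d₁, d₂, dw, hw, hbd, e₀, e₁, e₂⟩ :=
    solution_regularity hAB hT hg hg' hG hG' hu hK hsol
  have hG0 : 0 ≤ G := (norm_nonneg _).trans (hG 0)
  have h0T : (0 : ℝ) ∈ Icc 0 T := ⟨le_rfl, hT.le⟩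
  have hK0 : 0 ≤ K := (norm_nonneg _).trans (hbd 0 h0T).1
  have hlip := norm_sub_le_of_fderiv_bound hg hG
  have htime : ∀ k ≤ n, (k : ℝ) * τ ∈ Icc 0 T := fun k hk =>
    ⟨by positivity, le_trans (by gcongr) hn⟩
  have nw : ∀ t ∈ Icc 0 T, ‖w t‖ ≤ G * K := fun t ht => by
    rw [hw]
    exact ((fderiv ℝ g (u t)).le_opNorm _).trans
      (mul_le_mul (hG _) (hbd t ht).1 (norm_nonneg _) hG0)
  set R := Φ (stabSymbol (τ • α) (τ • β)) with hR
  set Ψ := Φ (errSymbol τ hτ (τ • α) (τ • β)) with hΨ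
  have nΨ : ∀ x, ‖Ψ x‖ ≤ κ * 3 * ‖x‖ := fun x =>
    norm_calculus_apply_le hΦ hκ (by norm_num) (abs_errSymbol_le _ hτ _ _) x
  have nR : ∀ (j : ℕ) (x : X), ‖(R ^ j) x‖ ≤ κ * ‖x‖ := fun j x => by
    rw [hR, ← map_pow]
    simpa only [mul_one] using
      norm_calculus_apply_le hΦ hκ zero_le_one (abs_stabSymbol_pow_le _ _ j) x
  set M := 3 * κ * (G * K) with hM
  set S := κ * G + 2 * κ * G * (κ * (1 + T * G) + 1) with hS
  have hM0 : 0 ≤ M := by positivity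
  have hS0 : 0 ≤ S := by positivity
  have hC1 : 0 ≤ localConst κ G K := by
    rw [localConst]
    positivity
  set E : ℕ → X := fun k => v k - u (k * τ) + (τ : ℝ) ^ 2 • Ψ (w (k * τ)) with hE
  set y := (S * M + localConst κ G K + 3 * κ * (G * K ^ 2 + G * K)) * (τ : ℝ) ^ 3 with hy
  have hy0 : 0 ≤ y := by positivity
  have ncorr : ∀ k ≤ n, ‖(τ : ℝ) ^ 2 • Ψ (w (k * τ))‖ ≤ (τ : ℝ) ^ 2 * M := fun k hk => by
    rw [norm_smul, Real.norm_of_nonneg (by positivity)]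
    refine mul_le_mul_of_nonneg_left ((nΨ _).trans ?_) (by positivity)
    have := mul_le_mul_of_nonneg_left (nw _ (htime k hk)) (by positivity : 0 ≤ κ * 3)
    linarith
  have hrec : ∀ k < n, ‖E (k + 1) - R (E k)‖ ≤ (τ : ℝ) * S * ‖E k‖ + y := fun k hk => by
    have ht := htime k hk.le
    have ht1 := htime (k + 1) hk
    have es : ((k + 1 : ℕ) : ℝ) * τ = k * τ + τ := by
      push_cast
      ring
    rw [es] at ht1
    have hτT : (τ : ℝ) ≤ T := by linarith [ht.1, ht1.2]
    set t := (k : ℝ) * τ with htdef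
    obtain ⟨hx, hstep⟩ := hv k hk
    have hgr := (hAB _ _).1 (LinearPMap.mem_graph (A + B) ⟨v k, hx⟩)
    obtain ⟨b₁, b₂, b₃, bw⟩ := hbd t ht
    have hstab := norm_stepMap_sub_le (τ := τ) hΦ hκ hG0 hlip hgr (e₀ t ht)
    rw [sub_add_cancel, ← hstep, ← hR] at hstab
    have hloc := norm_local_error_le (g := g) hΦ hκ hτ hG0 (hG (u t))
      (norm_linearization_le hg hg' hG' (u t)) (hw t) (e₁ t ht) (e₂ t ht) b₁ b₂ b₃ bw
      (norm_taylor_two_le d₀ d₁ d₂ (fun s hs => (hbd s hs).2.2.1) ht.1 hτ.le ht1.2)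
    rw [← hR, ← hΨ] at hloc
    have hwdiff : ‖w (t + τ) - w t‖ ≤ (G * K ^ 2 + G * K) * τ := by
      have := (convex_Icc 0 T).norm_image_sub_le_of_norm_hasDerivWithin_le dw
        (fun s hs => (hbd s hs).2.2.2) ht ht1
      rwa [add_sub_cancel_left, Real.norm_of_nonneg hτ.le] at this
    have hdecomp : E (k + 1) - R (E k) =
        (v (k + 1) - stepMap Φ α β g τ (u t) (u₁ t) - R (v k - u t)) -
        (u (t + τ) - stepMap Φ α β g τ (u t) (u₁ t) -
          (τ : ℝ) ^ 2 • (Ψ (w t) - R (Ψ (w t)))) +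
        (τ : ℝ) ^ 2 • Ψ (w (t + τ) - w t) := by
      simp only [hE, es, ← htdef]
      rw [map_add, ContinuousLinearMap.map_smul_of_tower, map_sub Ψ]
      module
    have n1 : ‖(τ : ℝ) ^ 2 • Ψ (w (t + τ) - w t)‖ ≤
        3 * κ * (G * K ^ 2 + G * K) * (τ : ℝ) ^ 3 := by
      rw [norm_smul, Real.norm_of_nonneg (by positivity)]
      calc _ ≤ (τ : ℝ) ^ 2 * (κ * 3 * ((G * K ^ 2 + G * K) * τ)) :=
            mul_le_mul_of_nonneg_left ((nΨ _).trans
              (mul_le_mul_of_nonneg_left hwdiff (by positivity))) (by positivity)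
        _ = _ := by ring
    have n2 : ‖v k - u t‖ ≤ ‖E k‖ + (τ : ℝ) ^ 2 * M := by
      have e : v k - u t = E k - (τ : ℝ) ^ 2 • Ψ (w t) := by
        simp only [hE, ← htdef]
        abel
      rw [e]
      exact (norm_sub_le _ _).trans (add_le_add_right (ncorr k hk.le) _)
    have n3 : (τ : ℝ) * (κ * G + 2 * κ * G * (κ * (1 + τ * G) + 1)) ≤ τ * S := by
      rw [hS]
      gcongr
    have n4 := hstab.trans (mul_le_mul n3 n2 (norm_nonneg _) (by positivity))
    rw [hdecomp]
    refine (norm_add_le _ _).trans ((add_le_add ((norm_sub_le _ _).trans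
      (add_le_add n4 hloc)) n1).trans (le_of_eq ?_))
    rw [hy]
    ring
  have hgron := norm_le_of_power_bounded hκ nR (by positivity) hy0 hrec n le_rfl
  have hE0 : ‖E 0‖ ≤ (τ : ℝ) ^ 2 * M := by
    have e : E 0 = (τ : ℝ) ^ 2 • Ψ (w ((0 : ℕ) * τ)) := by
      simp [hE, hv0]
    rw [e]
    exact ncorr 0 (Nat.zero_le _)
  have hpow : (1 + κ * (τ * S)) ^ n ≤ Real.exp (κ * S * T) := by
    calc (1 + κ * (τ * S)) ^ n ≤ Real.exp (κ * (τ * S)) ^ n := by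
          gcongr
          linarith [Real.add_one_le_exp (κ * (τ * S))]
      _ = Real.exp (κ * S * (n * τ)) := by
          rw [← Real.exp_nat_mul]
          ring_nf
      _ ≤ _ := by gcongr
  have hEn : ‖E n‖ ≤ Real.exp (κ * S * T) * (κ * M + T * (κ * (S * M + localConst κ G K +
      3 * κ * (G * K ^ 2 + G * K)))) * (τ : ℝ) ^ 2 := by
    refine hgron.trans ?_
    have h1 : κ * ‖E 0‖ + n * (κ * y) ≤ (κ * M + T * (κ * (S * M + localConst κ G K +
        3 * κ * (G * K ^ 2 + G * K)))) * (τ : ℝ) ^ 2 := by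
      have h2 := mul_le_mul_of_nonneg_left hE0 hκ
      have h3 : (n : ℝ) * (κ * y) = (n * τ) * (κ * (S * M + localConst κ G K +
          3 * κ * (G * K ^ 2 + G * K)) * (τ : ℝ) ^ 2) := by
        rw [hy]
        ring
      have h4 := mul_le_mul_of_nonneg_right hn (by positivity : 0 ≤ κ * (S * M +
        localConst κ G K + 3 * κ * (G * K ^ 2 + G * K)) * (τ : ℝ) ^ 2)
      rw [h3]
      linarith
    rw [mul_assoc]
    exact mul_le_mul hpow h1 (by positivity) (Real.exp_pos _).le
  have e : v n - u (n * τ) = E n - (τ : ℝ) ^ 2 • Ψ (w (n * τ)) := by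
    simp only [hE]
    abel
  rw [e]
  refine (norm_sub_le _ _).trans ((add_le_add hEn (ncorr n le_rfl)).trans (le_of_eq ?_))
  rw [convConst]
  ring

end Scheme

end SplitExp

theorem mainTheorem2 (T κ G K : ℝ) (hT : 0 < T) :
    ∃ C : ℝ,
      ∀ (X : Type*) [NormedAddCommGroup X] [NormedSpace ℂ X] [CompleteSpace X]
        (A B : X →ₗ.[ℂ] X) (SA SB SAB : SplitExp.C0Semigroup X),
        -- `A`, `B`, `A + B` generate analytic semigroups, and `A`, `B` commute
        SA.IsAnalyticGeneratedBy A → SB.IsAnalyticGeneratedBy B →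
        SAB.IsAnalyticGeneratedBy (A + B) →
        (∀ t : ℝ, 0 ≤ t → (SA.op t).comp (SB.op t) = (SB.op t).comp (SA.op t)) →
      -- `A` and `B` are simultaneously similar to multiplication operators
      ∀ (Y : Type*) [NormedAddCommGroup Y] [NormedSpace ℂ Y] [CompleteSpace Y]
        (Ω : Type*) [MeasurableSpace Ω] (μ : MeasureTheory.Measure Ω)
        (J : SplitExp.FunctionSpace Y μ) (V : X ≃L[ℂ] Y) (qA qB : Ω → ℝ),
        J.MulNormLE →
        MeasureTheory.AEStronglyMeasurable qA μ → MeasureTheory.AEStronglyMeasurable qB μ →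
        (∀ ω, qA ω ≤ 0) → (∀ ω, qB ω ≤ 0) →
        A = SplitExp.conjOp V (J.mulOp qA) → B = SplitExp.conjOp V (J.mulOp qB) →
        ‖(V : X →L[ℂ] Y)‖ * ‖(V.symm : Y →L[ℂ] X)‖ ≤ κ →
      -- `g` is twice Fréchet differentiable with uniformly bounded derivatives
      ∀ g : X → X, Differentiable ℝ g → Differentiable ℝ (fderiv ℝ g) →
        (∀ x, ‖fderiv ℝ g x‖ ≤ G) → (∀ x, ‖fderiv ℝ (fderiv ℝ g) x‖ ≤ G) →
      -- `u` is a smooth solution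
      ∀ u : ℝ → X, ContDiffOn ℝ 3 u (Set.Icc 0 T) →
        (∀ j ∈ Finset.Icc 1 3, ∀ t ∈ Set.Icc 0 T,
          ‖iteratedDerivWithin j u (Set.Icc 0 T) t‖ ≤ K) →
        SplitExp.IsSolution (A + B) g T u →
        (∀ t ∈ Set.Icc 0 T, ∀ s ∈ Set.Icc 0 T,
          g (u t) - g (u s) ∈ SplitExp.domProd B A) →
      -- the scheme is well defined and converges with order two
      ∀ τ : ℝ, 0 < τ →
        (∃ v : ℕ → X, v 0 = u 0 ∧
          ∀ n, SplitExp.IsERK2Step A B SA SB g τ (v n) (v (n + 1))) ∧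
        ∀ (N : ℕ) (v : ℕ → X), v 0 = u 0 →
          (∀ n < N, SplitExp.IsERK2Step A B SA SB g τ (v n) (v (n + 1))) →
          ∀ n ≤ N, (n : ℝ) * τ ≤ T → ‖v n - u (n * τ)‖ ≤ C * τ ^ 2 := by
  refine ⟨SplitExp.convConst T κ G K, ?_⟩
  intro X _ _ _ A B SA SB SAB hSA hSB _ _ Y _ _ _ Ω _ μ J V qA qB hJ hmA hmB hqA hqB hA hB hκ g hg
    hg' hG hG' u hu hK hsol _ τ hτ
  obtain ⟨Φ, hΦ, hinj, hΦA, hΦB, hΦAB⟩ :=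
    SplitExp.exists_joint_calculus hJ hSA hSB hmA hmB hqA hqB hA hB
  have hΦκ : ∀ F, ‖Φ F‖ ≤ κ * ‖F‖ := fun F =>
    (hΦ F).trans (mul_le_mul_of_nonneg_right hκ (norm_nonneg F))
  have hκ0 : 0 ≤ κ := le_trans (by positivity) hκ
  lift τ to NNReal using hτ.le
  have hstep := SplitExp.isERK2Step_iff (g := g) (τ := τ) hΦκ hinj hΦA hΦB hSA hSB
  simp only [hstep]
  refine ⟨?_, fun N v hv0 hv n hn hnT => SplitExp.convergence hΦκ hκ0 hτ hΦAB hT hg hg' hG hG' hu hK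
    hsol hv0 (fun k hk => hv k (hk.trans_le hn)) hnT⟩
  -- the initial value lies in the domain, and every step maps the domain into itself
  obtain ⟨u₁, -, -, -, -, -, -, -, -, -, -, e₀, -, -⟩ :=
    SplitExp.solution_regularity hΦAB hT hg hg' hG hG' hu hK hsol
  have hu0 : u 0 ∈ (A + B).domain :=
    SplitExp.mem_domain_of_eq_inv hΦAB (e₀ 0 ⟨le_rfl, hT.le⟩).symm
  let step : (A + B).domain → (A + B).domain := fun x =>
    ⟨_, SplitExp.stepMap_mem_domain (g := g) hΦAB (by exact_mod_cast hτ) x.2 ((A + B) x + g x)⟩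
  refine ⟨fun n => (step^[n] ⟨u 0, hu0⟩ : (A + B).domain), rfl, fun n => ⟨Subtype.prop _, ?_⟩⟩
  simp only [Function.iterate_succ_apply']
  rfl
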